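/- For probability measures $\mu,\nu$ on $\mathbb{R}^d$ (with Euclidean norm $|\cdot|$) let $$W_2(\mu,\nu)=\Big(\inf_{\gamma}\int_{\mathbb{R}^d\times\mathbb{R}^d}|x-y|^2\,d\gamma(x,y)\Big)^{1/2}\in[0,+\infty],$$ the infimum being over all probability measures $\gamma$ on $\mathbb{R}^d\times\mathbb{R}^d$ with marginals $\mu$ and $\nu$, and let $$\chi_2(\nu|\mu)=\Big(\int_{\mathbb{R}^d}\Big(\frac{d\nu}{d\mu}-1\Big)^2d\mu\Big)^{1/2}\in[0,+\infty]$$ if $\nu$ is absolutely continuous with respect to $\mu$, and $\chi_2(\nu|\mu)=+\infty$ otherwise. For $C\ge 0$, a probability measure $\mu$ on $\mathbb{R}^d$ is said to satisfy the transport-chi-square inequality $\mathcal{T}_\chi(C)$ if $W_2(\mu,\nu)\le\sqrt{C}\,\chi_2(\nu|\mu)$ for every probability measure $\nu$ on $\mathbb{R}^d$ (the inequality being regarded as void when $\chi_2(\nu|\mu)=+\infty$). **Theorem 2.** Let $C_1,C_2\ge 0$. If $\mu_1$ and $\mu_2$ are probability measures on $\mathbb{R}^{d_1}$ and $\mathbb{R}^{d_2}$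 satisfying $\mathcal{T}_\chi(C_1)$ and $\mathcal{T}_\chi(C_2)$ respectively, then the product measure $\mu_1\otimes\mu_2$ on $\mathbb{R}^{d_1+d_2}$ satisfies $\mathcal{T}_\chi(C)$ with $$C=\min\Big(C_1+C_2\big(1+\sqrt{(3d_2+2)d_2}\big),\;C_2+C_1\big(1+\sqrt{(3d_1+2)d_1}\big)\Big).$$ -/

import Mathlib

open MeasureTheory
open scoped ENNReal

noncomputable section

/-- The quadratic Wasserstein distance `W₂(μ, ν)`, valued in `[0, ∞]`: the square root of the infimum
of `∫ |x - y|² dγ(x, y)` over all couplings `γ` of `μ` and `ν`, that is, all measures on the product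
with first marginal `μ` and second marginal `ν` (they are probability measures as soon as `μ` is). -/
def wasserstein2 {E : Type*} [NormedAddCommGroup E] [MeasurableSpace E] (μ ν : Measure E) : ℝ≥0∞ :=
  (⨅ (γ : Measure (E × E)) (_ : γ.map Prod.fst = μ) (_ : γ.map Prod.snd = ν),
    ∫⁻ p, ‖p.1 - p.2‖ₑ ^ 2 ∂γ) ^ (1 / 2 : ℝ)

open scoped Classical in
/-- The square `χ₂²(ν|μ)` of the chi-square pseudo-distance, valued in `[0, ∞]`:
`∫ (dν/dμ - 1)² dμ` if `ν` is absolutely continuous with respect to `μ`, and `+∞` otherwise. -/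
def chiSquare {E : Type*} [MeasurableSpace E] (ν μ : Measure E) : ℝ≥0∞ :=
  if ν ≪ μ then ∫⁻ x, ENNReal.ofReal (((ν.rnDeriv μ x).toReal - 1) ^ 2) ∂μ else ∞

/-- The chi-square pseudo-distance `χ₂(ν|μ)`, valued in `[0, ∞]`. -/
def chi2 {E : Type*} [MeasurableSpace E] (ν μ : Measure E) : ℝ≥0∞ :=
  chiSquare ν μ ^ (1 / 2 : ℝ)

/-- The transport-chi-square inequality `T_χ(C)` for the probability measure `μ`:
`W₂(μ, ν) ≤ √C χ₂(ν|μ)` for all probability measures `ν`. The inequality is void when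
`χ₂(ν|μ) = +∞`; this is automatic for `C > 0`, and is written out because of `C = 0`, where
`0 * ∞ = 0` in `ℝ≥0∞`. The constant `C` is meant to be nonnegative. -/
def TransportChiSquare {E : Type*} [NormedAddCommGroup E] [MeasurableSpace E]
    (μ : Measure E) (C : ℝ) : Prop :=
  ∀ ν : Measure E, IsProbabilityMeasure ν → chi2 ν μ ≠ ∞ →
    wasserstein2 μ ν ≤ ENNReal.ofReal (√C) * chi2 ν μ

/-- The tensor product `μ₁ ⊗ μ₂` of measures on `ℝ^{d₁}` and `ℝ^{d₂}`, as a measure on the Euclidean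
space `ℝ^{d₁ + d₂}`, by concatenation of coordinates. -/
def tensorMeasure {d₁ d₂ : ℕ} (μ₁ : Measure (EuclideanSpace ℝ (Fin d₁)))
    (μ₂ : Measure (EuclideanSpace ℝ (Fin d₂))) : Measure (EuclideanSpace ℝ (Fin (d₁ + d₂))) :=
  (μ₁.prod μ₂).map (EuclideanSpace.finAddEquivProd (𝕜 := ℝ) (n := d₁) (m := d₂)).symm

end

/-! Write `ν = h • (μ₁ ⊗ μ₂)`, so that `χ₂²` is `∫ (h - 1)² d(μ₁ ⊗ μ₂)`. The first coordinates are
transported using the inequality for `μ₁`. Averaging `h` over the second variable does not increase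
the chi-square integral, so this costs at most `C₁ χ₂²`. The second coordinates are transported over
each thin strip `A × ℝᵈ`, from `μ₂` to the second marginal of `ν` normalized on the strip.

Let `r` be the mean of `h` over the strip and `X` the chi-square of that marginal. The strip enters
the total cost with weight `μ₁(A) r`, whereas its share of `χ₂²` is at least `μ₁(A) (r² X + (r -
1)²)`. The hypothesis on `μ₂` gives only `r C₂ X`, which `r² X` does not control for small `r`. If
`r T ≥ 1` (`T` is `tensorConst d`), then `r X ≤ T r² X` suffices. If `r T < 1`, the product coupling
is used. Its cost is bounded by `2 d C₂ + 2 C₂ √(d X)`, and the term `(r - 1)²`, now bounded below,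
absorbs what `r² X` cannot. Hence the factor `T` in front of `C₂` (`exists_coupling_of_mass`).

The bound on the product coupling rests on two consequences of the transport inequality: variances
of 1-Lipschitz functions are at most `C`, and second moments move by at most `2 √V √(C χ₂²)`, where
`V` is the second moment under `μ`. Both come from testing on perturbations of `μ` (`variance_le`,
`integral_norm_sq_sub_le_sqrt`).

A countable partition into small cells replaces disintegration in the first variable, so no
measurable choice of conditional couplings is needed; the error tends to zero with the mesh
(`exists_coupling_prod_of_partition`). -/

section

open Filter ProbabilityTheory
open scoped Topology

/-- `γ` is a coupling of `μ` and `ν`. -/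
structure IsCoupling {α β : Type*} [MeasurableSpace α] [MeasurableSpace β]
    (γ : Measure (α × β)) (μ : Measure α) (ν : Measure β) : Prop where
  map_fst : γ.map Prod.fst = μ
  map_snd : γ.map Prod.snd = ν

/-! ### Marginals of couplings. -/

section Coupling

variable {α β : Type*} [MeasurableSpace α] [MeasurableSpace β]
  {γ : Measure (α × β)} {μ : Measure α} {ν : Measure β}

theorem IsCoupling.isProbabilityMeasure [IsProbabilityMeasure μ] (h : IsCoupling γ μ ν) :
    IsProbabilityMeasure γ := by
  constructor
  have := congrArg (fun m => m Set.univ) h.map_fst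
  simpa [Measure.map_apply measurable_fst MeasurableSet.univ] using this

theorem IsCoupling.measurePreserving_fst (h : IsCoupling γ μ ν) :
    MeasurePreserving Prod.fst γ μ := ⟨measurable_fst, h.map_fst⟩

theorem IsCoupling.measurePreserving_snd (h : IsCoupling γ μ ν) :
    MeasurePreserving Prod.snd γ ν := ⟨measurable_snd, h.map_snd⟩

theorem IsCoupling.prod [IsProbabilityMeasure μ] [IsProbabilityMeasure ν] :
    IsCoupling (μ.prod ν) μ ν :=
  ⟨by simp, by simp⟩

end Coupling

/-! ### The transport inequality in terms of near-optimal couplings. -/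

section Transport

variable {E : Type*} [NormedAddCommGroup E] [MeasurableSpace E] {μ ν : Measure E} {C : ℝ}

theorem rpow_half_le_iff {a b : ℝ≥0∞} : a ^ (1 / 2 : ℝ) ≤ b ^ (1 / 2 : ℝ) ↔ a ≤ b :=
  ENNReal.rpow_le_rpow_iff (by norm_num)

theorem ofReal_sqrt_mul_rpow_half (hC : 0 ≤ C) (a : ℝ≥0∞) :
    ENNReal.ofReal (√C) * a ^ (1 / 2 : ℝ) = (ENNReal.ofReal C * a) ^ (1 / 2 : ℝ) := by
  rw [ENNReal.mul_rpow_of_nonneg _ _ (by norm_num), ENNReal.ofReal_rpow_of_nonneg hC (by norm_num),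
    Real.sqrt_eq_rpow]

/-- Any `w` strictly above the bound is reached by some coupling, so existence of an optimal
coupling is never needed. -/
theorem TransportChiSquare.exists_coupling (h : TransportChiSquare μ C) (hC : 0 ≤ C)
    [IsProbabilityMeasure ν] {X w : ℝ} (hX : chiSquare ν μ ≤ ENNReal.ofReal X)
    (hX0 : 0 ≤ X) (hw : C * X < w) :
    ∃ γ, IsCoupling γ μ ν ∧ ∫⁻ p, ‖p.1 - p.2‖ₑ ^ 2 ∂γ ≤ ENNReal.ofReal w := by
  have hfin : chi2 ν μ ≠ ∞ :=
    ENNReal.rpow_ne_top_of_nonneg (by norm_num) (ne_top_of_le_ne_top ENNReal.ofReal_ne_top hX)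
  have h1 := h ν inferInstance hfin
  rw [chi2, ofReal_sqrt_mul_rpow_half hC, wasserstein2, rpow_half_le_iff] at h1
  have h2 : ENNReal.ofReal C * chiSquare ν μ < ENNReal.ofReal w := by
    calc _ ≤ ENNReal.ofReal C * ENNReal.ofReal X := by gcongr
      _ = ENNReal.ofReal (C * X) := (ENNReal.ofReal_mul hC).symm
      _ < _ := (ENNReal.ofReal_lt_ofReal_iff (lt_of_le_of_lt (by positivity) hw)).2 hw
  obtain ⟨γ, h3⟩ := iInf_lt_iff.1 (h1.trans_lt h2)
  obtain ⟨hf, h4⟩ := iInf_lt_iff.1 h3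
  obtain ⟨hs, h5⟩ := iInf_lt_iff.1 h4
  exact ⟨γ, ⟨hf, hs⟩, h5.le⟩

theorem transportChiSquare_of_exists_coupling (hC : 0 ≤ C)
    (h : ∀ ν : Measure E, IsProbabilityMeasure ν → chiSquare ν μ ≠ ∞ → ∀ w : ℝ,
      C * (chiSquare ν μ).toReal < w →
      ∃ γ, IsCoupling γ μ ν ∧ ∫⁻ p, ‖p.1 - p.2‖ₑ ^ 2 ∂γ ≤ ENNReal.ofReal w) :
    TransportChiSquare μ C := by
  intro ν hν hfin
  have hfin' : chiSquare ν μ ≠ ∞ := by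
    intro h0
    apply hfin
    rw [chi2, h0]
    simp
  rw [chi2, ofReal_sqrt_mul_rpow_half hC, wasserstein2, rpow_half_le_iff]
  rw [← ENNReal.ofReal_toReal hfin', ← ENNReal.ofReal_mul hC]
  refine ENNReal.le_of_forall_pos_le_add fun ε hε _ => ?_
  obtain ⟨γ, hγ, hc⟩ := h ν hν hfin' (C * (chiSquare ν μ).toReal + ε) (by simpa using hε)
  refine (iInf_le_of_le γ <| iInf_le_of_le hγ.map_fst <| iInf_le_of_le hγ.map_snd hc).trans ?_
  rw [ENNReal.ofReal_add (by positivity) (by positivity), ENNReal.ofReal_coe_nnreal]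

end Transport

/-! ### Chi-square distance through real densities. -/

section Density

variable {α β : Type*} [MeasurableSpace α] [MeasurableSpace β] {μ ν : Measure α}

theorem chiSquare_withDensity [SigmaFinite μ] {h : α → ℝ} (hm : Measurable h) (h0 : 0 ≤ h) :
    chiSquare (μ.withDensity fun x => ENNReal.ofReal (h x)) μ
      = ∫⁻ x, ENNReal.ofReal ((h x - 1) ^ 2) ∂μ := by
  rw [chiSquare, if_pos (withDensity_absolutelyContinuous _ _)]
  refine lintegral_congr_ae ?_
  filter_upwards [Measure.rnDeriv_withDensity μ hm.ennreal_ofReal] with x hx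
  rw [hx, ENNReal.toReal_ofReal (h0 x)]

theorem exists_density_of_chiSquare_ne_top [SigmaFinite μ] [IsFiniteMeasure ν]
    (hfin : chiSquare ν μ ≠ ∞) :
    ∃ h : α → ℝ, Measurable h ∧ 0 ≤ h ∧ ν = μ.withDensity (fun x => ENNReal.ofReal (h x)) := by
  have hac : ν ≪ μ := by
    by_contra hc
    exact hfin (by rw [chiSquare, if_neg hc])
  refine ⟨fun x => (ν.rnDeriv μ x).toReal, (Measure.measurable_rnDeriv _ _).ennreal_toReal,
    fun _ => ENNReal.toReal_nonneg, ?_⟩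
  conv_lhs => rw [← Measure.withDensity_rnDeriv_eq ν μ hac]
  refine withDensity_congr_ae ?_
  filter_upwards [Measure.rnDeriv_lt_top ν μ] with x hx
  rw [ENNReal.ofReal_toReal hx.ne]

theorem chiSquare_map_equiv [SigmaFinite μ] [SigmaFinite ν] (e : α ≃ᵐ β) :
    chiSquare (ν.map e) (μ.map e) = chiSquare ν μ := by
  have hiff : ν.map e ≪ μ.map e ↔ ν ≪ μ :=
    ⟨fun hc => by simpa using hc.map e.symm.measurable, fun hc => hc.map e.measurable⟩
  by_cases hac : ν ≪ μ
  · rw [chiSquare, chiSquare, if_pos hac, if_pos (hiff.2 hac), lintegral_map_equiv]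
    refine lintegral_congr_ae ?_
    filter_upwards [e.measurableEmbedding.rnDeriv_map ν μ] with x hx
    rw [hx]
  · rw [chiSquare, chiSquare, if_neg hac, if_neg (fun hc => hac (hiff.1 hc))]

/-- A density with finite chi-square integral is square integrable. -/
theorem memLp_of_lintegral_sq_sub_one [IsFiniteMeasure μ] {h : α → ℝ} (hm : Measurable h)
    (hfin : ∫⁻ x, ENNReal.ofReal ((h x - 1) ^ 2) ∂μ ≠ ∞) : MemLp (fun x => h x - 1) 2 μ := by
  refine (memLp_two_iff_integrable_sq (hm.sub_const 1).aestronglyMeasurable).2 ?_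
  exact (lintegral_ofReal_ne_top_iff_integrable
    ((hm.sub_const 1).pow_const 2).aestronglyMeasurable
    (Filter.Eventually.of_forall fun _ => sq_nonneg _)).1 hfin

end Density

/-! ### Finite second moments, and first estimates on Lipschitz and quadratic functions. -/

section Moments

theorem integral_mul_le_sqrt_mul_sqrt {α : Type*} [MeasurableSpace α] {μ : Measure α}
    {f g : α → ℝ} (hf : MemLp f 2 μ) (hg : MemLp g 2 μ) :
    ∫ x, f x * g x ∂μ ≤ √(∫ x, f x ^ 2 ∂μ) * √(∫ x, g x ^ 2 ∂μ) := by
  have key := integral_mul_norm_le_Lp_mul_Lq (μ := μ) (f := f) (g := g) Real.HolderConjugate.two_two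
    (by simpa using hf) (by simpa using hg)
  have e : ∀ u : α → ℝ, (∫ x, ‖u x‖ ^ (2 : ℝ) ∂μ) ^ (1 / (2 : ℝ)) = √(∫ x, u x ^ 2 ∂μ) := by
    intro u
    rw [Real.sqrt_eq_rpow]
    simp
  rw [e, e] at key
  refine le_trans (integral_mono (hf.integrable_mul hg) (hf.norm.integrable_mul hg.norm)
    fun x => ?_) key
  simpa [abs_mul] using le_abs_self (f x * g x)

theorem integral_le_sqrt_integral_sq {α : Type*} [MeasurableSpace α] {μ : Measure α}
    [IsProbabilityMeasure μ] {f : α → ℝ} (hf : MemLp f 2 μ) :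
    ∫ x, f x ∂μ ≤ √(∫ x, f x ^ 2 ∂μ) := by
  simpa using integral_mul_le_sqrt_mul_sqrt hf (memLp_const (1 : ℝ))

/-- Perturbing a probability measure by the density `1 + f`. -/
theorem exists_perturbation {α : Type*} [MeasurableSpace α] {μ : Measure α}
    [IsProbabilityMeasure μ] {f : α → ℝ} (hm : Measurable f) (hf : MemLp f 2 μ)
    (h0 : ∫ x, f x ∂μ = 0) (h1 : ∀ x, -1 ≤ f x) :
    ∃ ν : Measure α, IsProbabilityMeasure ν ∧ chiSquare ν μ = ENNReal.ofReal (∫ x, f x ^ 2 ∂μ) ∧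
      ∀ ψ : α → ℝ, ∫ x, ψ x ∂ν = ∫ x, (1 + f x) * ψ x ∂μ := by
  have hp : ∀ x, 0 ≤ 1 + f x := fun x => by linarith [h1 x]
  have hi : Integrable f μ := hf.integrable (by norm_num)
  refine ⟨μ.withDensity fun x => ENNReal.ofReal (1 + f x), ⟨?_⟩, ?_, fun ψ => ?_⟩
  · rw [withDensity_apply _ MeasurableSet.univ, Measure.restrict_univ,
      ← ofReal_integral_eq_lintegral_ofReal (f := fun x => 1 + f x)
        ((integrable_const _).add hi) (Filter.Eventually.of_forall hp),
      integral_add (integrable_const _) hi, h0]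
    simp
  · rw [chiSquare_withDensity (hm.const_add 1) hp, ofReal_integral_eq_lintegral_ofReal
      hf.integrable_sq (Filter.Eventually.of_forall fun _ => sq_nonneg _)]
    simp
  · rw [integral_withDensity_eq_integral_toReal_smul (hm.const_add 1).ennreal_ofReal (by simp)]
    simp only [smul_eq_mul, ENNReal.toReal_ofReal (hp _)]

variable {E : Type*} [NormedAddCommGroup E] [MeasurableSpace E] [BorelSpace E]
  [SecondCountableTopology E] {μ ν : Measure E} {C X : ℝ} {γ : Measure (E × E)}

theorem memLp_sub_of_lintegral_ne_top (h : ∫⁻ p, ‖p.1 - p.2‖ₑ ^ 2 ∂γ ≠ ∞) :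
    MemLp (fun p : E × E => p.1 - p.2) 2 γ := by
  refine ⟨(measurable_fst.sub measurable_snd).aestronglyMeasurable, ?_⟩
  rw [eLpNorm_lt_top_iff_lintegral_rpow_enorm_lt_top (by norm_num) (by norm_num)]
  simpa using h.lt_top

theorem integral_norm_sub_sq_le {w : ℝ} (hw : 0 ≤ w)
    (h : ∫⁻ p, ‖p.1 - p.2‖ₑ ^ 2 ∂γ ≤ ENNReal.ofReal w) :
    ∫ p, ‖p.1 - p.2‖ ^ 2 ∂γ ≤ w := by
  rw [integral_eq_lintegral_of_nonneg_ae (Filter.Eventually.of_forall fun _ => by positivity)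
    (f := fun p : E × E => ‖p.1 - p.2‖ ^ 2)
    ((measurable_fst.sub measurable_snd).norm.pow_const 2).aestronglyMeasurable]
  refine ENNReal.toReal_le_of_le_ofReal hw (le_trans (le_of_eq ?_) h)
  refine lintegral_congr fun p => ?_
  rw [ENNReal.ofReal_pow (norm_nonneg _), ofReal_norm]

theorem memLp_id_fst_of_coupling (hγ : IsCoupling γ μ ν) (h : ∫⁻ p, ‖p.1 - p.2‖ₑ ^ 2 ∂γ ≠ ∞)
    (hν : MemLp id 2 ν) : MemLp id 2 μ := by
  have h1 : MemLp (fun p : E × E => p.1) 2 γ := by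
    have := (memLp_sub_of_lintegral_ne_top h).add (hν.comp_measurePreserving
      hγ.measurePreserving_snd)
    exact this.ae_eq (Filter.Eventually.of_forall fun p => by simp)
  rw [← hγ.map_fst]
  exact (memLp_map_measure_iff measurable_id.aestronglyMeasurable measurable_fst.aemeasurable).2 h1

theorem memLp_id_snd_of_coupling (hγ : IsCoupling γ μ ν) (h : ∫⁻ p, ‖p.1 - p.2‖ₑ ^ 2 ∂γ ≠ ∞)
    (hμ : MemLp id 2 μ) : MemLp id 2 ν := by
  have h1 : MemLp (fun p : E × E => p.2) 2 γ := by
    have := (hμ.comp_measurePreserving hγ.measurePreserving_fst).sub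
      (memLp_sub_of_lintegral_ne_top h)
    exact this.ae_eq (Filter.Eventually.of_forall fun p => by simp)
  rw [← hγ.map_snd]
  exact (memLp_map_measure_iff measurable_id.aestronglyMeasurable measurable_snd.aemeasurable).2 h1

/-- A measure satisfying a transport-chi-square inequality has a finite second moment: compare it
with its conditioning on a ball. -/
theorem TransportChiSquare.memLp_id [IsProbabilityMeasure μ] (h : TransportChiSquare μ C)
    (hC : 0 ≤ C) : MemLp id 2 μ := by
  obtain ⟨n, hn⟩ : ∃ n : ℕ, μ (Metric.ball (0 : E) n) ≠ 0 := by
    by_contra! hc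
    have h1 : μ (⋃ n : ℕ, Metric.ball (0 : E) n) = 0 := measure_iUnion_null_iff.2 hc
    rw [Metric.iUnion_ball_nat] at h1
    simp at h1
  set B := Metric.ball (0 : E) n with hB
  have hBm : MeasurableSet B := measurableSet_ball
  set p := μ.real B with hp
  have hp0 : 0 < p := by
    rw [hp, measureReal_def]
    exact ENNReal.toReal_pos hn (measure_ne_top _ _)
  have hp1 : p ≤ 1 := measureReal_le_one
  set f : E → ℝ := fun x => B.indicator (fun _ => p⁻¹) x - 1 with hf
  have hfm : Measurable f := (measurable_const.indicator hBm).sub_const 1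
  have hfb : ∀ x, 0 ≤ B.indicator (fun _ => p⁻¹) x ∧ B.indicator (fun _ => p⁻¹) x ≤ p⁻¹ := by
    intro x
    by_cases hx : x ∈ B <;> simp [hx, hp0.le]
  have hfL : MemLp f 2 μ := by
    refine (MemLp.of_bound (measurable_const.indicator hBm).aestronglyMeasurable (p⁻¹)
      (Filter.Eventually.of_forall fun x => ?_)).sub (memLp_const 1)
    rw [Real.norm_eq_abs, abs_of_nonneg (hfb x).1]
    exact (hfb x).2
  have hf0 : ∫ x, f x ∂μ = 0 := by
    rw [hf, integral_sub ((integrable_const _).indicator hBm) (integrable_const _),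
      integral_indicator hBm]
    simp [← hp, hp0.ne']
  obtain ⟨ν, hν, hchi, hint⟩ := exists_perturbation hfm hfL hf0 (fun x => by
    have := (hfb x).1
    simp only [hf]
    linarith)
  obtain ⟨γ, hγ, hcost⟩ := h.exists_coupling hC hchi.le (integral_nonneg fun _ => sq_nonneg _)
    (lt_add_one _)
  refine memLp_id_fst_of_coupling hγ (ne_top_of_le_ne_top ENNReal.ofReal_ne_top hcost) ?_
  -- The conditioned measure lives on a ball, so its second moment is finite; a coupling of finite
  -- cost carries this back to `μ`.
  have hνB : ν.real Bᶜ = 0 := by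
    have := hint (Bᶜ.indicator fun _ => 1)
    rw [integral_indicator hBm.compl] at this
    simp only [integral_const, smul_eq_mul, mul_one, measureReal_restrict_apply_univ] at this
    rw [this]
    refine integral_eq_zero_of_ae (Filter.Eventually.of_forall fun x => ?_)
    by_cases hx : x ∈ B <;> simp [hx, hf]
  have hνB' : ∀ᵐ x ∂ν, x ∈ B := by
    rw [ae_iff]
    exact (measureReal_eq_zero_iff).1 hνB
  refine MemLp.of_bound measurable_id.aestronglyMeasurable n ?_
  filter_upwards [hνB'] with x hx
  simpa [hB] using (mem_ball_zero_iff.1 hx).le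

omit [SecondCountableTopology E] in
theorem MemLp.of_lipschitzWith_one [IsFiniteMeasure μ] (hμ : MemLp id 2 μ) {ψ : E → ℝ}
    (hψ : LipschitzWith 1 ψ) : MemLp ψ 2 μ := by
  have h1 : MemLp (fun x => ‖x‖ + |ψ 0|) 2 μ := hμ.norm.add (memLp_const _)
  refine h1.mono hψ.continuous.measurable.aestronglyMeasurable
    (Filter.Eventually.of_forall fun x => ?_)
  have := hψ.dist_le_mul x 0
  simp only [Real.dist_eq, dist_zero_right, NNReal.coe_one, one_mul] at this
  rw [Real.norm_eq_abs, Real.norm_eq_abs]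
  have h2 := abs_sub_abs_le_abs_sub (ψ x) (ψ 0)
  exact (by linarith : |ψ x| ≤ ‖x‖ + |ψ 0|).trans (le_abs_self _)

/-- A fixed bound on a quantity valid for all `w > w₀` is valid at `w₀`. -/
theorem le_of_forall_gt_of_continuous {F : ℝ → ℝ} (hF : Continuous F) {a w₀ : ℝ}
    (h : ∀ w, w₀ < w → a ≤ F w) : a ≤ F w₀ := by
  refine ge_of_tendsto (hF.continuousWithinAt (s := Set.Ioi w₀)) ?_
  filter_upwards [self_mem_nhdsWithin] with w hw using h w hw

theorem TransportChiSquare.memLp_id_of_chiSquare_le [IsProbabilityMeasure μ]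
    [IsProbabilityMeasure ν] (h : TransportChiSquare μ C) (hC : 0 ≤ C) (hX0 : 0 ≤ X)
    (hX : chiSquare ν μ ≤ ENNReal.ofReal X) : MemLp id 2 ν := by
  obtain ⟨γ, hγ, hcost⟩ := h.exists_coupling hC hX hX0 (lt_add_one _)
  exact memLp_id_snd_of_coupling hγ (ne_top_of_le_ne_top ENNReal.ofReal_ne_top hcost)
    (h.memLp_id hC)

theorem TransportChiSquare.integral_sub_le_of_lipschitzWith [IsProbabilityMeasure μ]
    [IsProbabilityMeasure ν] (h : TransportChiSquare μ C) (hC : 0 ≤ C) (hX0 : 0 ≤ X)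
    (hX : chiSquare ν μ ≤ ENNReal.ofReal X) {ψ : E → ℝ} (hψ : LipschitzWith 1 ψ) :
    ∫ x, ψ x ∂ν - ∫ x, ψ x ∂μ ≤ √(C * X) := by
  refine le_of_forall_gt_of_continuous Real.continuous_sqrt fun w hw => ?_
  obtain ⟨γ, hγ, hcost⟩ := h.exists_coupling hC hX hX0 hw
  have hL := memLp_sub_of_lintegral_ne_top (ne_top_of_le_ne_top ENNReal.ofReal_ne_top hcost)
  have := hγ.isProbabilityMeasure
  have hi1 : Integrable (fun p : E × E => ψ p.1) γ :=
    ((MemLp.of_lipschitzWith_one (h.memLp_id hC) hψ).comp_measurePreserving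
      hγ.measurePreserving_fst).integrable (by norm_num)
  have hi2 : Integrable (fun p : E × E => ψ p.2) γ :=
    ((MemLp.of_lipschitzWith_one (h.memLp_id_of_chiSquare_le hC hX0 hX) hψ).comp_measurePreserving
      hγ.measurePreserving_snd).integrable (by norm_num)
  have hψm : Measurable ψ := hψ.continuous.measurable
  rw [← hγ.map_fst, ← hγ.map_snd, integral_map measurable_fst.aemeasurable
    hψm.aestronglyMeasurable, integral_map measurable_snd.aemeasurable hψm.aestronglyMeasurable,
    ← integral_sub hi2 hi1]
  calc ∫ p, (ψ p.2 - ψ p.1) ∂γ ≤ ∫ p, ‖p.1 - p.2‖ ∂γ := by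
        refine integral_mono (hi2.sub hi1) (hL.norm.integrable (by norm_num)) fun p => ?_
        have := hψ.dist_le_mul p.1 p.2
        simp only [dist_eq_norm, NNReal.coe_one, one_mul, Real.norm_eq_abs] at this
        linarith [neg_abs_le (ψ p.1 - ψ p.2)]
    _ ≤ √(∫ p, ‖p.1 - p.2‖ ^ 2 ∂γ) := integral_le_sqrt_integral_sq hL.norm
    _ ≤ √w := Real.sqrt_le_sqrt
        (integral_norm_sub_sq_le (lt_of_le_of_lt (by positivity) hw).le hcost)

/-- Triangle inequality and Cauchy–Schwarz along a near-optimal coupling. The term `C * X` is of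
second order and disappears under small perturbations of `μ`. -/
theorem TransportChiSquare.integral_norm_sq_sub_le [IsProbabilityMeasure μ]
    [IsProbabilityMeasure ν] (h : TransportChiSquare μ C) (hC : 0 ≤ C) (hX0 : 0 ≤ X)
    (hX : chiSquare ν μ ≤ ENNReal.ofReal X) (m : E) :
    ∫ x, ‖x - m‖ ^ 2 ∂ν - ∫ x, ‖x - m‖ ^ 2 ∂μ
      ≤ 2 * √(∫ x, ‖x - m‖ ^ 2 ∂μ) * √(C * X) + C * X := by
  refine le_of_forall_gt_of_continuous
    (F := fun w => 2 * √(∫ x, ‖x - m‖ ^ 2 ∂μ) * √w + w) (by fun_prop) fun w hw => ?_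
  have hw0 : 0 ≤ w := (lt_of_le_of_lt (by positivity) hw).le
  obtain ⟨γ, hγ, hcost⟩ := h.exists_coupling hC hX hX0 hw
  have hL := memLp_sub_of_lintegral_ne_top (ne_top_of_le_ne_top ENNReal.ofReal_ne_top hcost)
  have := hγ.isProbabilityMeasure
  have hL1 : MemLp (fun p : E × E => p.1 - m) 2 γ :=
    ((h.memLp_id hC).sub (memLp_const m)).comp_measurePreserving hγ.measurePreserving_fst
  have hL2 : MemLp (fun p : E × E => p.2 - m) 2 γ :=
    ((h.memLp_id_of_chiSquare_le hC hX0 hX).sub (memLp_const m)).comp_measurePreserving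
      hγ.measurePreserving_snd
  have hi1 := hL1.norm.integrable_sq
  have hi2 := hL2.norm.integrable_sq
  have hm : Measurable fun x : E => ‖x - m‖ ^ 2 := by fun_prop
  have e1 : ∫ x, ‖x - m‖ ^ 2 ∂μ = ∫ p, ‖p.1 - m‖ ^ 2 ∂γ := by
    rw [← hγ.map_fst, integral_map measurable_fst.aemeasurable hm.aestronglyMeasurable]
  have e2 : ∫ x, ‖x - m‖ ^ 2 ∂ν = ∫ p, ‖p.2 - m‖ ^ 2 ∂γ := by
    rw [← hγ.map_snd, integral_map measurable_snd.aemeasurable hm.aestronglyMeasurable]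
  have hcw := integral_norm_sub_sq_le hw0 hcost
  rw [e1, e2, ← integral_sub hi2 hi1]
  have hi3 : Integrable (fun p : E × E => 2 * (‖p.1 - m‖ * ‖p.1 - p.2‖)) γ :=
    (hL1.norm.integrable_mul hL.norm).const_mul 2
  calc ∫ p, (‖p.2 - m‖ ^ 2 - ‖p.1 - m‖ ^ 2) ∂γ
      ≤ ∫ p, (2 * (‖p.1 - m‖ * ‖p.1 - p.2‖) + ‖p.1 - p.2‖ ^ 2) ∂γ := by
        refine integral_mono (hi2.sub hi1) (hi3.add hL.norm.integrable_sq) fun p => ?_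
        have h1 : ‖p.2 - m‖ ≤ ‖p.1 - m‖ + ‖p.1 - p.2‖ := by
          have := norm_sub_le (p.1 - m) (p.1 - p.2)
          rwa [show p.1 - m - (p.1 - p.2) = p.2 - m by abel] at this
        have h2 := pow_le_pow_left₀ (norm_nonneg _) h1 2
        simp only
        linarith [add_sq ‖p.1 - m‖ ‖p.1 - p.2‖]
    _ = 2 * ∫ p, ‖p.1 - m‖ * ‖p.1 - p.2‖ ∂γ + ∫ p, ‖p.1 - p.2‖ ^ 2 ∂γ := by
        rw [integral_add hi3 hL.norm.integrable_sq, integral_const_mul]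
    _ ≤ 2 * (√(∫ p, ‖p.1 - m‖ ^ 2 ∂γ) * √(∫ p, ‖p.1 - p.2‖ ^ 2 ∂γ)) + w := by
        gcongr
        exact integral_mul_le_sqrt_mul_sqrt hL1.norm hL.norm
    _ ≤ 2 * √(∫ p, ‖p.1 - m‖ ^ 2 ∂γ) * √w + w := by
        rw [mul_assoc]
        gcongr

end Moments

/-! ### Variance and second-moment bounds by perturbation. -/

section Variance

variable {E : Type*} [NormedAddCommGroup E] [MeasurableSpace E] [BorelSpace E]
  [SecondCountableTopology E] {μ ν : Measure E} {C X : ℝ}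

theorem le_of_le_sqrt_mul_self {v C : ℝ} (hC : 0 ≤ C) (h : v ≤ √(C * v)) : v ≤ C := by
  rcases le_or_gt v 0 with hv | hv
  · exact hv.trans hC
  · have h2 := (Real.le_sqrt hv.le (by positivity)).1 h
    exact le_of_mul_le_mul_right (by nlinarith) hv

theorem integral_sub_integral_sq {α : Type*} [MeasurableSpace α] {μ : Measure α}
    [IsProbabilityMeasure μ] {f : α → ℝ} (hf : MemLp f 2 μ) :
    ∫ x, (f x - ∫ y, f y ∂μ) ^ 2 ∂μ = ∫ x, f x ^ 2 ∂μ - (∫ x, f x ∂μ) ^ 2 := by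
  have h1 := ProbabilityTheory.variance_eq_integral hf.aestronglyMeasurable.aemeasurable
  have h2 := ProbabilityTheory.variance_eq_sub hf
  rw [h1] at h2
  simpa using h2

/-- With `v` the variance, test on the density `1 + t (ψ - a)`: the mean of `ψ` moves by `t v`,
while the allowed displacement is `√(C t² v)`. Hence `v ≤ √(C v)`, for any admissible `t` and
without a limit. -/
theorem TransportChiSquare.variance_le_of_bounded [IsProbabilityMeasure μ]
    (h : TransportChiSquare μ C) (hC : 0 ≤ C) {ψ : E → ℝ} (hψ : LipschitzWith 1 ψ) {M : ℝ}
    (hM : ∀ x, |ψ x| ≤ M) : ∫ x, (ψ x - ∫ y, ψ y ∂μ) ^ 2 ∂μ ≤ C := by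
  have hψm : Measurable ψ := hψ.continuous.measurable
  have hψL : MemLp ψ 2 μ := MemLp.of_bound hψm.aestronglyMeasurable M (Eventually.of_forall hM)
  have hψi : Integrable ψ μ := hψL.integrable (by norm_num)
  have hM0 : 0 ≤ M := (abs_nonneg _).trans (hM 0)
  set a := ∫ y, ψ y ∂μ with ha
  have haM : |a| ≤ M := by
    have := norm_integral_le_of_norm_le_const (μ := μ) (f := ψ) (Eventually.of_forall hM)
    simpa using this
  -- Since `|ψ - a| ≤ 2 M`, this `t` keeps the density nonnegative; the `+ 1` covers `M = 0`.
  set t : ℝ := (2 * M + 1)⁻¹ with ht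
  have ht0 : 0 < t := by positivity
  have hfL : MemLp (fun x => ψ x - a) 2 μ := hψL.sub (memLp_const a)
  have hf0 : ∫ x, (ψ x - a) ∂μ = 0 := by
    rw [integral_sub hψi (integrable_const _)]
    simp [ha]
  set v := ∫ x, (ψ x - a) ^ 2 ∂μ with hv
  obtain ⟨ν, hν, hchi, hint⟩ := exists_perturbation (f := fun x => t * (ψ x - a))
    (by fun_prop) (hfL.const_mul t) (by rw [integral_const_mul, hf0, mul_zero]) (fun x => by
      have h1 : |ψ x - a| ≤ 2 * M + 1 := by
        have := abs_sub (ψ x) a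
        linarith [hM x]
      have h2 : |t * (ψ x - a)| ≤ 1 := by
        rw [abs_mul, abs_of_pos ht0, ht, inv_mul_le_iff₀ (by positivity)]
        linarith
      linarith [neg_abs_le (t * (ψ x - a))])
  have key := h.integral_sub_le_of_lipschitzWith hC (integral_nonneg fun _ => sq_nonneg _)
    hchi.le hψ
  have e1 : ∫ x, (t * (ψ x - a)) ^ 2 ∂μ = t ^ 2 * v := by
    simp_rw [mul_pow]
    rw [integral_const_mul]
  have e2 : ∫ x, ψ x ∂ν - ∫ x, ψ x ∂μ = t * v := by
    have h3 : ∀ x, (1 + t * (ψ x - a)) * ψ x = ψ x + (t * (ψ x - a) ^ 2 + t * a * (ψ x - a)) := by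
      intro x; ring
    have i1 : Integrable (fun x => t * (ψ x - a) ^ 2) μ := hfL.integrable_sq.const_mul t
    have i2 : Integrable (fun x => t * a * (ψ x - a)) μ :=
      (hfL.integrable (by norm_num)).const_mul _
    rw [hint]
    simp_rw [h3]
    rw [integral_add hψi (g := fun x => t * (ψ x - a) ^ 2 + t * a * (ψ x - a)) (i1.add i2),
      integral_add i1 i2, integral_const_mul, integral_const_mul,
      hf0]
    ring
  rw [e1, e2, show C * (t ^ 2 * v) = t ^ 2 * (C * v) by ring, Real.sqrt_mul (sq_nonneg t),
    Real.sqrt_sq ht0.le] at key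
  exact le_of_le_sqrt_mul_self hC (le_of_mul_le_mul_left key ht0)

/-- Truncation at levels `± n`. -/
def truncate (n : ℕ) (s : ℝ) : ℝ := max (-(n : ℝ)) (min n s)

theorem abs_truncate_le (n : ℕ) (s : ℝ) : |truncate n s| ≤ n := by
  have : (0 : ℝ) ≤ n := n.cast_nonneg
  exact abs_le.2 ⟨le_max_left _ _, max_le (by linarith) (min_le_left _ _)⟩

theorem abs_truncate_le_abs (n : ℕ) (s : ℝ) : |truncate n s| ≤ |s| := by
  have hn : (0 : ℝ) ≤ n := n.cast_nonneg
  refine abs_le.2 ⟨?_, max_le (by linarith [abs_nonneg s]) ((min_le_right _ _).trans (le_abs_self s))⟩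
  refine le_trans (le_min ?_ (neg_abs_le s)) (le_max_right _ _)
  linarith [abs_nonneg s]

theorem lipschitzWith_truncate (n : ℕ) : LipschitzWith 1 (truncate n) :=
  (LipschitzWith.id.const_min _).const_max _

theorem tendsto_truncate (s : ℝ) : Tendsto (fun n => truncate n s) atTop (𝓝 s) := by
  refine tendsto_const_nhds.congr' ?_
  obtain ⟨N, hN⟩ := exists_nat_ge |s|
  filter_upwards [eventually_ge_atTop N] with n hn
  have : |s| ≤ n := hN.trans (by exact_mod_cast hn)
  rw [truncate, min_eq_right ((le_abs_self s).trans this), max_eq_right]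
  linarith [neg_abs_le s]

theorem TransportChiSquare.variance_le [IsProbabilityMeasure μ]
    (h : TransportChiSquare μ C) (hC : 0 ≤ C) {ψ : E → ℝ} (hψ : LipschitzWith 1 ψ) :
    ∫ x, (ψ x - ∫ y, ψ y ∂μ) ^ 2 ∂μ ≤ C := by
  have hψL := MemLp.of_lipschitzWith_one (h.memLp_id hC) hψ
  have hψi : Integrable ψ μ := hψL.integrable (by norm_num)
  have hψm : Measurable ψ := hψ.continuous.measurable
  have hTm : ∀ n, Measurable fun x => truncate n (ψ x) := fun n =>
    (lipschitzWith_truncate n).continuous.measurable.comp hψm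
  rw [integral_sub_integral_sq hψL]
  have t1 : Tendsto (fun n => ∫ x, truncate n (ψ x) ∂μ) atTop (𝓝 (∫ x, ψ x ∂μ)) :=
    tendsto_integral_of_dominated_convergence (fun x => |ψ x|)
      (fun n => (hTm n).aestronglyMeasurable) hψi.abs
      (fun n => Eventually.of_forall fun x => abs_truncate_le_abs n (ψ x))
      (Eventually.of_forall fun x => tendsto_truncate (ψ x))
  have t2 : Tendsto (fun n => ∫ x, truncate n (ψ x) ^ 2 ∂μ) atTop (𝓝 (∫ x, ψ x ^ 2 ∂μ)) :=
    tendsto_integral_of_dominated_convergence (fun x => ψ x ^ 2)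
      (fun n => ((hTm n).pow_const 2).aestronglyMeasurable) hψL.integrable_sq
      (fun n => Eventually.of_forall fun x => by
        rw [Real.norm_eq_abs, abs_pow, ← sq_abs (ψ x)]
        exact pow_le_pow_left₀ (abs_nonneg _) (abs_truncate_le_abs n (ψ x)) 2)
      (Eventually.of_forall fun x => (tendsto_truncate (ψ x)).pow 2)
  refine le_of_tendsto (t2.sub (t1.pow 2)) (Eventually.of_forall fun n => ?_)
  have hL : LipschitzWith 1 fun x => truncate n (ψ x) := by
    have := (lipschitzWith_truncate n).comp hψ
    rwa [one_mul] at this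
  rw [← integral_sub_integral_sq (MemLp.of_lipschitzWith_one (h.memLp_id hC) hL)]
  exact h.variance_le_of_bounded hC hL fun x => abs_truncate_le n (ψ x)

/-- Second moments under `ν` are controlled by the chi-square distance to `μ`: test the
inequality on the mixtures `(1 - t) μ + t ν` and let `t → 0`. -/
theorem TransportChiSquare.integral_norm_sq_sub_le_sqrt [IsProbabilityMeasure μ]
    [IsProbabilityMeasure ν] (h : TransportChiSquare μ C) (hC : 0 ≤ C)
    (hfin : chiSquare ν μ ≠ ∞) (m : E) :
    ∫ x, ‖x - m‖ ^ 2 ∂ν - ∫ x, ‖x - m‖ ^ 2 ∂μ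
      ≤ 2 * √(∫ x, ‖x - m‖ ^ 2 ∂μ) * √(C * (chiSquare ν μ).toReal) := by
  obtain ⟨g, hgm, hg0, hν⟩ := exists_density_of_chiSquare_ne_top hfin
  have hνL : MemLp id 2 ν := h.memLp_id_of_chiSquare_le hC ENNReal.toReal_nonneg
    (ENNReal.ofReal_toReal hfin).ge
  have hchi := chiSquare_withDensity (μ := μ) hgm hg0
  rw [← hν] at hchi
  set f : E → ℝ := fun x => g x - 1 with hf_def
  have hm : Measurable f := hgm.sub_const 1
  have h1 : ∀ x, -1 ≤ f x := fun x => by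
    have : 0 ≤ g x := hg0 x
    simp only [hf_def]
    linarith
  have hf : MemLp f 2 μ := memLp_of_lintegral_sq_sub_one hgm (hchi ▸ hfin)
  have hX : (chiSquare ν μ).toReal = ∫ x, f x ^ 2 ∂μ := by
    rw [hchi, ← ofReal_integral_eq_lintegral_ofReal hf.integrable_sq
      (Eventually.of_forall fun _ => sq_nonneg _),
      ENNReal.toReal_ofReal (integral_nonneg fun _ => sq_nonneg _)]
  have hint : ∀ ψ : E → ℝ, ∫ x, ψ x ∂ν = ∫ x, (1 + f x) * ψ x ∂μ := by
    intro ψ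
    rw [hν, integral_withDensity_eq_integral_toReal_smul hgm.ennreal_ofReal (by simp)]
    simp [hf_def, ENNReal.toReal_ofReal (hg0 _)]
  have h0 : ∫ x, f x ∂μ = 0 := by
    have h2 := hint fun _ => 1
    simp only [mul_one] at h2
    rw [integral_add (integrable_const _) (hf.integrable (by norm_num))] at h2
    simpa using h2
  rw [hX]
  set V := ∫ x, ‖x - m‖ ^ 2 ∂μ with hV
  set X := ∫ x, f x ^ 2 ∂μ with hX'
  set D := ∫ x, ‖x - m‖ ^ 2 ∂ν - V with hD
  have hVi : Integrable (fun x => ‖x - m‖ ^ 2) μ :=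
    ((h.memLp_id hC).sub (memLp_const m)).norm.integrable_sq
  have hgi : Integrable (fun x => (1 + f x) * ‖x - m‖ ^ 2) μ := by
    have h2 : Integrable (fun x => ‖x - m‖ ^ 2) ν := (hνL.sub (memLp_const m)).norm.integrable_sq
    rw [hν, integrable_withDensity_iff_integrable_smul' hgm.ennreal_ofReal (by simp)] at h2
    simpa [hf_def, ENNReal.toReal_ofReal (hg0 _)] using h2
  have hfi : Integrable (fun x => f x * ‖x - m‖ ^ 2) μ :=
    (hgi.sub hVi).congr (Eventually.of_forall fun x => by simp only [Pi.sub_apply]; ring)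
  have hDf : D = ∫ x, f x * ‖x - m‖ ^ 2 ∂μ := by
    rw [hD, hint, hV, ← integral_sub hgi hVi]
    congr 1 with x
    ring
  -- On the mixture the moment difference is `t D` and the chi-square is `t² X`. After division by
  -- `t` only the second-order term keeps a factor `t`.
  have key : ∀ t ∈ Set.Ioc (0 : ℝ) 1, D ≤ 2 * √V * √(C * X) + t * (C * X) := by
    rintro t ⟨ht0, ht1⟩
    obtain ⟨ν', hν', hchi', hint'⟩ := exists_perturbation (f := fun x => t * f x)
      (by fun_prop) (hf.const_mul t) (by rw [integral_const_mul, h0, mul_zero])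
      (fun x => by nlinarith [h1 x])
    have e1 : ∫ x, (t * f x) ^ 2 ∂μ = t ^ 2 * X := by
      simp_rw [mul_pow]
      rw [integral_const_mul]
    have e2 : ∫ x, ‖x - m‖ ^ 2 ∂ν' - V = t * D := by
      rw [hint', hV, ← integral_sub ?_ hVi, hDf, ← integral_const_mul]
      · congr 1 with x
        ring
      · exact (hVi.add (hfi.const_mul t)).congr (Eventually.of_forall fun x => by
          simp only [Pi.add_apply]
          ring)
    have := h.integral_norm_sq_sub_le hC (integral_nonneg fun _ => sq_nonneg _) hchi'.le m
    rw [e1, ← hV, e2, show C * (t ^ 2 * X) = t ^ 2 * (C * X) by ring, Real.sqrt_mul (sq_nonneg t),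
      Real.sqrt_sq ht0.le] at this
    refine le_of_mul_le_mul_left (this.trans (le_of_eq (by ring))) ht0
  have hlim : Tendsto (fun t : ℝ => 2 * √V * √(C * X) + t * (C * X)) (𝓝[>] 0)
      (𝓝 (2 * √V * √(C * X))) := by
    have : Tendsto (fun t : ℝ => 2 * √V * √(C * X) + t * (C * X)) (𝓝[>] 0)
      (𝓝 (2 * √V * √(C * X) + 0 * (C * X))) :=
      (Continuous.tendsto (by fun_prop) 0).mono_left nhdsWithin_le_nhds
    simpa using this
  refine ge_of_tendsto hlim ?_
  filter_upwards [Ioc_mem_nhdsGT (zero_lt_one (α := ℝ))] with t ht using key t ht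

end Variance

/-! ### The product coupling on Euclidean space and the dimensional constant. -/

section Euclidean

variable {d : ℕ} {μ ν : Measure (EuclideanSpace ℝ (Fin d))} {C : ℝ}

theorem lipschitzWith_coordinate (i : Fin d) :
    LipschitzWith 1 fun x : EuclideanSpace ℝ (Fin d) => x i :=
  LipschitzWith.of_dist_le_mul fun x y => by
    simpa [dist_eq_norm] using PiLp.norm_apply_le (x - y) i

/-- The mean of a measure on Euclidean space. -/
noncomputable def meanVector (μ : Measure (EuclideanSpace ℝ (Fin d))) : EuclideanSpace ℝ (Fin d) :=
  WithLp.toLp 2 fun i => ∫ x, x i ∂μ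

theorem memLp_coordinate [IsProbabilityMeasure μ] (hμ : MemLp id 2 μ)
    (m : EuclideanSpace ℝ (Fin d)) (i : Fin d) :
    MemLp (fun x : EuclideanSpace ℝ (Fin d) => x i - m i) 2 μ :=
  (MemLp.of_lipschitzWith_one hμ (lipschitzWith_coordinate i)).sub (memLp_const _)

/-- Each coordinate is 1-Lipschitz, so contributes a variance of at most `C`. This is where the
dimension enters. -/
theorem TransportChiSquare.integral_norm_sub_meanVector_sq_le [IsProbabilityMeasure μ]
    (h : TransportChiSquare μ C) (hC : 0 ≤ C) : ∫ x, ‖x - meanVector μ‖ ^ 2 ∂μ ≤ d * C := by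
  have e : ∀ x : EuclideanSpace ℝ (Fin d),
      ‖x - meanVector μ‖ ^ 2 = ∑ i, (x i - ∫ y, y i ∂μ) ^ 2 := by
    intro x
    rw [EuclideanSpace.real_norm_sq_eq]
    simp [meanVector]
  simp_rw [e]
  rw [integral_finsetSum (f := fun i (x : EuclideanSpace ℝ (Fin d)) => (x i - ∫ y, y i ∂μ) ^ 2) _
    fun i _ => (memLp_coordinate (h.memLp_id hC) (meanVector μ) i).integrable_sq]
  refine (Finset.sum_le_card_nsmul _ _ C fun i _ =>
    h.variance_le hC (lipschitzWith_coordinate i)).trans (by simp)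

/-- The quadratic cost of the product coupling. -/
theorem integral_norm_sub_sq_prod [IsProbabilityMeasure μ] [IsProbabilityMeasure ν]
    (hμ : MemLp id 2 μ) (hν : MemLp id 2 ν) :
    ∫ p, ‖p.1 - p.2‖ ^ 2 ∂(μ.prod ν)
      = ∫ x, ‖x - meanVector μ‖ ^ 2 ∂μ + ∫ y, ‖y - meanVector μ‖ ^ 2 ∂ν := by
  set m := meanVector μ with hm
  have hμi : Integrable (fun x => ‖x - m‖ ^ 2) μ := (hμ.sub (memLp_const m)).norm.integrable_sq
  have hνi : Integrable (fun x => ‖x - m‖ ^ 2) ν := (hν.sub (memLp_const m)).norm.integrable_sq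
  have i1 : Integrable (fun p : _ × _ => ‖p.1 - m‖ ^ 2) (μ.prod ν) := hμi.comp_fst ν
  have i2 : Integrable (fun p : _ × _ => ‖p.2 - m‖ ^ 2) (μ.prod ν) := hνi.comp_snd μ
  have hci : ∀ i, Integrable (fun x : EuclideanSpace ℝ (Fin d) => x i - m i) μ := fun i =>
    (memLp_coordinate hμ m i).integrable (by norm_num)
  have hci' : ∀ i, Integrable (fun x : EuclideanSpace ℝ (Fin d) => x i - m i) ν := fun i =>
    (memLp_coordinate hν m i).integrable (by norm_num)
  have i3 : ∀ i, Integrable (fun p : EuclideanSpace ℝ (Fin d) × EuclideanSpace ℝ (Fin d) =>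
      (p.1 i - m i) * (p.2 i - m i)) (μ.prod ν) := fun i => (hci i).mul_prod (hci' i)
  have e : ∀ p : EuclideanSpace ℝ (Fin d) × EuclideanSpace ℝ (Fin d), ‖p.1 - p.2‖ ^ 2
      = (‖p.1 - m‖ ^ 2 + ‖p.2 - m‖ ^ 2) - 2 * ∑ i, (p.1 i - m i) * (p.2 i - m i) := by
    intro p
    simp only [EuclideanSpace.real_norm_sq_eq, PiLp.sub_apply, Finset.mul_sum,
      ← Finset.sum_add_distrib, ← Finset.sum_sub_distrib]
    exact Finset.sum_congr rfl fun i _ => by ring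
  -- Centering at the mean of `μ` kills the cross terms, whatever the mean of `ν`.
  have hz : ∀ i, ∫ x, (x i - m i) ∂μ = 0 := by
    intro i
    have hi : Integrable (fun x : EuclideanSpace ℝ (Fin d) => x i) μ :=
      (MemLp.of_lipschitzWith_one hμ (lipschitzWith_coordinate i)).integrable (by norm_num)
    rw [integral_sub hi (integrable_const _)]
    simp [hm, meanVector]
  simp_rw [e]
  rw [integral_sub (f := fun p : _ × _ => ‖p.1 - m‖ ^ 2 + ‖p.2 - m‖ ^ 2) (i1.add i2)
      ((integrable_finsetSum _ fun i _ => i3 i).const_mul 2),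
    integral_add i1 i2, integral_const_mul, integral_finsetSum _ fun i _ => i3 i]
  have hz' : ∀ i, ∫ p : EuclideanSpace ℝ (Fin d) × EuclideanSpace ℝ (Fin d),
      (p.1 i - m i) * (p.2 i - m i) ∂(μ.prod ν) = 0 := fun i => by
    rw [integral_prod_mul (fun x : EuclideanSpace ℝ (Fin d) => x i - m i)
      (fun x : EuclideanSpace ℝ (Fin d) => x i - m i), hz i, zero_mul]
  simp_rw [hz']
  rw [integral_fun_fst (fun x => ‖x - m‖ ^ 2), integral_fun_snd (fun x => ‖x - m‖ ^ 2)]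
  simp

/-- The dimensional constant of the tensorization theorem. -/
noncomputable def tensorConst (d : ℕ) : ℝ := 1 + √((3 * (d : ℝ) + 2) * (d : ℝ))

theorem tensorConst_pos (d : ℕ) : 0 < tensorConst d := by
  unfold tensorConst
  positivity

/-- Put `T = 1 + K` and multiply by `T`. Then `2 T √d a ≤ T² a² + d` and `2 d r T ≤ 2 d`, while `r T
< 1` gives `T (1 - r) ≥ K`. It remains to see `3 d ≤ K²`, which holds because `d` is an integer. -/
theorem moment_bound_le_tensorConst (d : ℕ) {r a : ℝ}
    (hlt : r * tensorConst d < 1) :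
    2 * r * d + 2 * √d * a ≤ tensorConst d * (a ^ 2 + (r - 1) ^ 2) := by
  set K := √((3 * (d : ℝ) + 2) * (d : ℝ)) with hK
  have hK0 : 0 ≤ K := Real.sqrt_nonneg _
  have hK2 : K ^ 2 = (3 * (d : ℝ) + 2) * d := Real.sq_sqrt (by positivity)
  have hT : tensorConst d = 1 + K := rfl
  rw [hT] at hlt ⊢
  have hs2 : √(d : ℝ) ^ 2 = d := Real.sq_sqrt (by positivity)
  set s := √(d : ℝ) with hs
  have hs0 : 0 ≤ s := Real.sqrt_nonneg _
  have hd3 : (d : ℝ) ≤ 3 * (d : ℝ) ^ 2 := by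
    have : (d : ℝ) ≤ (d : ℝ) ^ 2 := by exact_mod_cast Nat.le_self_pow (by norm_num) d
    nlinarith [sq_nonneg (d : ℝ)]
  refine le_of_mul_le_mul_left ?_ (show 0 < 1 + K by linarith)
  have h1 : K ^ 2 ≤ ((1 + K) * (1 - r)) ^ 2 := pow_le_pow_left₀ hK0 (by linarith) 2
  have h2 : r * (1 + K) * (2 * d) ≤ 1 * (2 * d) := by gcongr
  nlinarith [sq_nonneg ((1 + K) * a - s)]

/-- The transport-chi-square inequality for `ν` weighted by a mass `r`: for `r` close to `0` the
product coupling does better than the optimal one. -/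
theorem TransportChiSquare.exists_coupling_of_mass [IsProbabilityMeasure μ]
    [IsProbabilityMeasure ν] (h : TransportChiSquare μ C) (hC : 0 ≤ C) {X r w : ℝ} (hX0 : 0 ≤ X)
    (hX : chiSquare ν μ ≤ ENNReal.ofReal X) (hr : 0 < r)
    (hw : C * tensorConst d * ((r ^ 2 * X + (r - 1) ^ 2) / r) < w) :
    ∃ γ, IsCoupling γ μ ν ∧ ∫⁻ p, ‖p.1 - p.2‖ₑ ^ 2 ∂γ ≤ ENNReal.ofReal w := by
  have hT := tensorConst_pos d
  -- For `r T ≥ 1`, `X ≤ T r X` and the near-optimal coupling is good enough; below this threshold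
  -- the product coupling takes over.
  rcases le_or_gt 1 (r * tensorConst d) with hrT | hrT
  · refine h.exists_coupling hC hX hX0 (lt_of_le_of_lt ?_ hw)
    rw [mul_assoc]
    refine mul_le_mul_of_nonneg_left ?_ hC
    rw [mul_div_assoc', le_div_iff₀ hr]
    nlinarith [mul_nonneg hT.le (sq_nonneg (r - 1)),
      mul_le_mul_of_nonneg_right hrT (mul_nonneg hr.le hX0)]
  · refine ⟨μ.prod ν, IsCoupling.prod, ?_⟩
    have hμL := h.memLp_id hC
    have hνL := h.memLp_id_of_chiSquare_le hC hX0 hX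
    have hfin := ne_top_of_le_ne_top ENNReal.ofReal_ne_top hX
    have hVd := h.integral_norm_sub_meanVector_sq_le hC
    have hD := h.integral_norm_sq_sub_le_sqrt hC hfin (meanVector μ)
    have hX' : (chiSquare ν μ).toReal ≤ X := ENNReal.toReal_le_of_le_ofReal hX0 hX
    have hcost : ∫ p, ‖p.1 - p.2‖ ^ 2 ∂(μ.prod ν) ≤ 2 * (d * C) + 2 * (C * √d * √X) := by
      rw [integral_norm_sub_sq_prod hμL hνL]
      have h1 : √(∫ x, ‖x - meanVector μ‖ ^ 2 ∂μ) * √(C * (chiSquare ν μ).toReal)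
          ≤ C * √d * √X := by
        calc _ ≤ √(d * C) * √(C * X) := by gcongr
          _ = C * √d * √X := by
            rw [Real.sqrt_mul (by positivity), Real.sqrt_mul hC]
            linear_combination (√d * √X) * Real.mul_self_sqrt hC
      linarith
    have hmain : 2 * (d * C) + 2 * (C * √d * √X) < w := by
      refine lt_of_le_of_lt ?_ hw
      rw [mul_div_assoc', le_div_iff₀ hr]
      have h2 := mul_le_mul_of_nonneg_left
        (moment_bound_le_tensorConst d (a := r * √X) hrT) hC
      rw [mul_pow, Real.sq_sqrt hX0] at h2
      linarith
    have hint : Integrable (fun p : EuclideanSpace ℝ (Fin d) × EuclideanSpace ℝ (Fin d) =>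
        ‖p.1 - p.2‖ ^ 2) (μ.prod ν) :=
      ((hμL.comp_fst ν).sub (hνL.comp_snd μ)).norm.integrable_sq
    calc ∫⁻ p, ‖p.1 - p.2‖ₑ ^ 2 ∂(μ.prod ν)
        = ∫⁻ p, ENNReal.ofReal (‖p.1 - p.2‖ ^ 2) ∂(μ.prod ν) := lintegral_congr fun p => by
          rw [ENNReal.ofReal_pow (norm_nonneg _), ofReal_norm]
      _ = ENNReal.ofReal (∫ p, ‖p.1 - p.2‖ ^ 2 ∂(μ.prod ν)) :=
          (ofReal_integral_eq_lintegral_ofReal hint (Eventually.of_forall fun _ => by positivity)).symm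
      _ ≤ ENNReal.ofReal w := ENNReal.ofReal_le_ofReal (hcost.trans hmain.le)

end Euclidean

/-! ### Contraction of chi-square under marginals. -/

section Averaging

variable {α β : Type*} [MeasurableSpace α] [MeasurableSpace β]

theorem map_snd_withDensity_prod {μ : Measure α} {ν : Measure β} [SFinite μ] [SFinite ν]
    {h : α × β → ℝ≥0∞} (hm : Measurable h) :
    ((μ.prod ν).withDensity h).map Prod.snd = ν.withDensity fun y => ∫⁻ x, h (x, y) ∂μ := by
  ext s hs
  rw [Measure.map_apply measurable_snd hs, withDensity_apply _ (measurable_snd hs),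
    withDensity_apply _ hs, ← Set.univ_prod, ← Measure.prod_restrict, Measure.restrict_univ,
    lintegral_prod_symm' _ hm]

/-- Averaging a density over the first variable decreases the chi-square distance. -/
theorem exists_chiSquare_map_snd_le {μ : Measure α} {ν : Measure β} [IsProbabilityMeasure μ]
    [IsProbabilityMeasure ν] {h : α × β → ℝ} (hm : Measurable h) (h0 : 0 ≤ h)
    (hL : MemLp (fun p => h p - 1) 2 (μ.prod ν)) {r : ℝ} (hr : 0 < r)
    (hmass : ∫ p, h p ∂(μ.prod ν) = r) {σ : Measure (α × β)}
    (hσ : (μ.prod ν).withDensity (fun p => ENNReal.ofReal (h p)) = ENNReal.ofReal r • σ) :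
    ∃ X, 0 ≤ X ∧ chiSquare (σ.map Prod.snd) ν ≤ ENNReal.ofReal X ∧
      r ^ 2 * X + (r - 1) ^ 2 ≤ ∫ p, (h p - 1) ^ 2 ∂(μ.prod ν) := by
  set R : β → ℝ := fun y => ∫ x, h (x, y) ∂μ with hR
  have hi : Integrable h (μ.prod ν) :=
    ((hL.integrable (by norm_num)).add (integrable_const (1 : ℝ))).congr
      (Eventually.of_forall fun p => by simp)
  have hRm : Measurable R := (hm.stronglyMeasurable.integral_prod_left').measurable
  have hR0 : 0 ≤ R := fun y => integral_nonneg fun x => h0 (x, y)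
  have hRi : Integrable R ν := hi.integral_prod_right
  have hRint : ∫ y, R y ∂ν = r := by rw [← hmass, integral_prod_symm _ hi]
  have hsq : Integrable (fun p => (h p - 1) ^ 2) (μ.prod ν) := hL.integrable_sq
  -- Jensen's inequality on each fibre, as nonnegativity of a variance.
  have hle : ∀ᵐ y ∂ν, (R y - 1) ^ 2 ≤ ∫ x, (h (x, y) - 1) ^ 2 ∂μ := by
    filter_upwards [hi.prod_left_ae, hsq.prod_left_ae] with y hy1 hy2
    have hy3 : MemLp (fun x => h (x, y) - 1) 2 μ :=
      (memLp_two_iff_integrable_sq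
        ((hm.comp measurable_prodMk_right).sub_const 1).aestronglyMeasurable).2 hy2
    have h1 := integral_sub_integral_sq hy3
    have h2 : 0 ≤ ∫ x, (h (x, y) - 1 - ∫ x', (h (x', y) - 1) ∂μ) ^ 2 ∂μ :=
      integral_nonneg fun _ => sq_nonneg _
    have h3 : ∫ x, (h (x, y) - 1) ∂μ = R y - 1 := by
      rw [integral_sub hy1 (integrable_const _)]
      simp [hR]
    rw [h1, h3] at h2
    linarith
  have hRsq : Integrable (fun y => (R y - 1) ^ 2) ν := by
    refine hsq.integral_prod_right.mono ((hRm.sub_const 1).pow_const 2).aestronglyMeasurable ?_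
    filter_upwards [hle] with y hy
    rw [Real.norm_eq_abs, Real.norm_eq_abs, abs_of_nonneg (sq_nonneg _)]
    exact hy.trans (le_abs_self _)
  have hRL : MemLp (fun y => R y - 1) 2 ν := (memLp_two_iff_integrable_sq (by fun_prop)).2 hRsq
  have hdens : (fun y => ∫⁻ x, ENNReal.ofReal (h (x, y)) ∂μ) =ᵐ[ν]
      fun y => ENNReal.ofReal (R y) := by
    filter_upwards [hi.prod_left_ae] with y hy
    exact (ofReal_integral_eq_lintegral_ofReal hy (Eventually.of_forall fun x => h0 (x, y))).symm
  have hση : σ.map Prod.snd = ν.withDensity fun y => ENNReal.ofReal (r⁻¹ * R y) := by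
    have h1 : σ = ENNReal.ofReal r⁻¹ • (μ.prod ν).withDensity (fun p => ENNReal.ofReal (h p)) := by
      rw [hσ, smul_smul, ← ENNReal.ofReal_mul (by positivity), inv_mul_cancel₀ hr.ne']
      simp
    rw [h1, Measure.map_smul, map_snd_withDensity_prod hm.ennreal_ofReal,
      withDensity_congr_ae hdens, ← withDensity_smul _ hRm.ennreal_ofReal]
    congr 1 with y
    simp [ENNReal.ofReal_mul (inv_nonneg.2 hr.le)]
  have hXL : MemLp (fun y => r⁻¹ * R y - 1) 2 ν := by
    have h1 : MemLp (fun y => r⁻¹ * (R y - 1) + (r⁻¹ - 1)) 2 ν :=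
      (hRL.const_mul _).add (memLp_const _)
    exact h1.ae_eq (Eventually.of_forall fun y => by ring)
  refine ⟨∫ y, (r⁻¹ * R y - 1) ^ 2 ∂ν, integral_nonneg fun _ => sq_nonneg _, ?_, ?_⟩
  · rw [hση, chiSquare_withDensity (hRm.const_mul _)
      (fun y => mul_nonneg (inv_nonneg.2 hr.le) (hR0 y)),
      ofReal_integral_eq_lintegral_ofReal hXL.integrable_sq
        (Eventually.of_forall fun _ => sq_nonneg _)]
  · have h1 := integral_sub_integral_sq hRL
    have h2 : ∫ y, (R y - 1) ∂ν = r - 1 := by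
      rw [integral_sub hRi (integrable_const _), hRint]
      simp
    -- `R` has mean `r`, so `r² X` is its variance, and `r² X + (r - 1)²` is exactly `∫ (R - 1)²
    -- dν`.
    have h3 : r ^ 2 * ∫ y, (r⁻¹ * R y - 1) ^ 2 ∂ν = ∫ y, (R y - 1 - (r - 1)) ^ 2 ∂ν := by
      rw [← integral_const_mul]
      congr 1 with y
      field_simp
      ring
    have h4 : ∫ y, (R y - 1) ^ 2 ∂ν ≤ ∫ p, (h p - 1) ^ 2 ∂(μ.prod ν) := by
      rw [integral_prod_symm _ hsq]
      exact integral_mono_ae hRsq hsq.integral_prod_right hle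
    rw [h2] at h1
    linarith

end Averaging

/-! ### Gluing of couplings by disintegration. -/

section Gluing

variable {α β : Type*} [MeasurableSpace α] [MeasurableSpace β] [StandardBorelSpace α] [Nonempty α]

/-- A coupling of `μ` with the second marginal of `σ` extends to a coupling of `μ` with `σ`. -/
theorem exists_gluing {μ : Measure β} {σ : Measure (α × β)} [IsFiniteMeasure σ]
    {γ : Measure (β × β)} [IsFiniteMeasure γ] (hγ : IsCoupling γ μ (σ.map Prod.snd)) :
    ∃ Γ : Measure (β × α × β), IsCoupling Γ μ σ ∧
      Γ.map (fun p => (p.1, p.2.2)) = γ := by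
  set σ' : Measure (β × α) := σ.map Prod.swap with hσ'
  have hfst : σ'.fst = γ.map Prod.snd := by
    rw [hγ.map_snd, hσ', Measure.fst, Measure.map_map measurable_fst measurable_swap]
    rfl
  -- The missing coordinate is drawn from its conditional law under `σ` given the second point of
  -- `γ` alone.
  set κ : Kernel (β × β) α := σ'.condKernel.comap Prod.snd measurable_snd with hκ
  have hF : Measurable fun p : (β × β) × α => (p.1.1, p.2, p.1.2) := by fun_prop
  have hfst' : (γ ⊗ₘ κ).map Prod.fst = γ := Measure.fst_compProd γ κ
  refine ⟨(γ ⊗ₘ κ).map fun p => (p.1.1, p.2, p.1.2), ⟨?_, ?_⟩, ?_⟩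
  · rw [Measure.map_map measurable_fst hF]
    conv_rhs => rw [← hγ.map_fst, ← hfst', Measure.map_map measurable_fst measurable_fst]
    rfl
  · rw [Measure.map_map measurable_snd hF]
    have h1 : (γ ⊗ₘ κ).map (fun p => (p.1.2, p.2)) = σ' := by
      have hG : Measurable fun p : (β × β) × α => (p.1.2, p.2) := by fun_prop
      conv_rhs => rw [← σ'.disintegrate σ'.condKernel, hfst]
      ext s hs
      rw [Measure.map_apply hG hs, Measure.compProd_apply (hG hs), Measure.compProd_apply hs,
        lintegral_map (Kernel.measurable_kernel_prodMk_left hs) measurable_snd]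
      rfl
    have h2 : σ = σ'.map Prod.swap := by
      rw [hσ', Measure.map_map measurable_swap measurable_swap]
      simp
    rw [h2, ← h1, Measure.map_map measurable_swap (by fun_prop)]
    rfl
  · rw [Measure.map_map (by fun_prop) hF]
    exact hfst'

end Gluing

/-! ### Countable partitions of small mesh. -/

section Partition

theorem exists_measurable_partition_diam_le {E : Type*} [NormedAddCommGroup E] [MeasurableSpace E]
    [BorelSpace E] [SecondCountableTopology E] {δ : ℝ} (hδ : 0 < δ) :
    ∃ A : ℕ → Set E, (∀ k, MeasurableSet (A k)) ∧ Pairwise (Function.onFun Disjoint A) ∧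
      ⋃ k, A k = Set.univ ∧ ∀ k, ∀ x ∈ A k, ∀ y ∈ A k, ‖x - y‖ ≤ δ := by
  set B : ℕ → Set E := fun k => Metric.ball (TopologicalSpace.denseSeq E k) (δ / 2) with hB
  refine ⟨disjointed B, fun k => MeasurableSet.disjointed (fun _ => measurableSet_ball) k,
    disjoint_disjointed B, ?_, fun k x hx y hy => ?_⟩
  · rw [iUnion_disjointed, Set.eq_univ_iff_forall]
    intro x
    obtain ⟨k, hk⟩ := (TopologicalSpace.denseRange_denseSeq E).exists_dist_lt x (half_pos hδ)
    exact Set.mem_iUnion.2 ⟨k, hk⟩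
  · have h1 := disjointed_subset B k hx
    have h2 := disjointed_subset B k hy
    rw [← dist_eq_norm]
    have := dist_triangle_right x y (TopologicalSpace.denseSeq E k)
    simp only [hB, Metric.mem_ball] at h1 h2
    linarith

end Partition

/-! ### Couplings on strips and their assembly. -/

section Tensorization

variable {E : Type*} [NormedAddCommGroup E] [MeasurableSpace E] [BorelSpace E]
  [SecondCountableTopology E] [StandardBorelSpace E] {d : ℕ} {μ₁ : Measure E}
  {μ₂ : Measure (EuclideanSpace ℝ (Fin d))} [IsProbabilityMeasure μ₁] [IsProbabilityMeasure μ₂]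
  {C₁ C₂ : ℝ} {h : E × EuclideanSpace ℝ (Fin d) → ℝ}

omit [BorelSpace E] [SecondCountableTopology E] in
/-- On a strip `A × ℝᵈ`, couple `μ₂` with the normalized restriction of `ν = h • (μ₁ ⊗ μ₂)`. -/
theorem TransportChiSquare.exists_coupling_strip (h₂ : TransportChiSquare μ₂ C₂) (hC₂ : 0 ≤ C₂)
    (hm : Measurable h) (h0 : 0 ≤ h) (hL : MemLp (fun p => h p - 1) 2 (μ₁.prod μ₂))
    {ν : Measure (E × EuclideanSpace ℝ (Fin d))} [IsProbabilityMeasure ν]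
    (hν : ν = (μ₁.prod μ₂).withDensity fun p => ENNReal.ofReal (h p)) {A : Set E}
    (hA : MeasurableSet A) {ε : ℝ} (hε : 0 < ε) :
    ∃ Γ : Measure (EuclideanSpace ℝ (Fin d) × E × EuclideanSpace ℝ (Fin d)),
      Γ.map Prod.fst = μ₂ ∧
      ν (A ×ˢ Set.univ) • Γ.map Prod.snd = ν.restrict (A ×ˢ Set.univ) ∧
      ν (A ×ˢ Set.univ) * ∫⁻ p, ‖p.1 - p.2.2‖ₑ ^ 2 ∂Γ ≤
        ENNReal.ofReal (C₂ * tensorConst d) *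
          (∫⁻ p in A ×ˢ Set.univ, ENNReal.ofReal ((h p - 1) ^ 2) ∂(μ₁.prod μ₂))
        + ν (A ×ˢ Set.univ) * ENNReal.ofReal ε := by
  by_cases hνA : ν (A ×ˢ Set.univ) = 0
  · refine ⟨μ₂.prod ν, IsCoupling.prod.map_fst, ?_, by simp [hνA]⟩
    rw [hνA, zero_smul, Measure.restrict_eq_zero.2 hνA]
  have hi : Integrable h (μ₁.prod μ₂) :=
    ((hL.integrable (by norm_num)).add (integrable_const (1 : ℝ))).congr
      (Eventually.of_forall fun p => by simp)
  have hrestr : ν.restrict (A ×ˢ Set.univ)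
      = ((μ₁.restrict A).prod μ₂).withDensity fun p => ENNReal.ofReal (h p) := by
    rw [hν, restrict_withDensity (hA.prod MeasurableSet.univ), ← Measure.prod_restrict,
      Measure.restrict_univ]
  have hA0 : μ₁ A ≠ 0 := by
    intro hc
    apply hνA
    rw [← Measure.restrict_eq_zero, hrestr, Measure.restrict_eq_zero.2 hc]
    simp
  have := cond_isProbabilityMeasure hA0
  set m := μ₁[|A] with hm_def
  have hrestr₁ : μ₁.restrict A = μ₁ A • m := by
    rw [hm_def, ProbabilityTheory.cond, smul_smul, ENNReal.mul_inv_cancel hA0 (measure_ne_top _ _), one_smul]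
  have hprod : (μ₁.prod μ₂).restrict (A ×ˢ Set.univ) = μ₁ A • m.prod μ₂ := by
    rw [← Measure.prod_restrict, Measure.restrict_univ, hrestr₁, Measure.prod_smul_left]
  have hscale : m.prod μ₂ = (μ₁ A)⁻¹ • (μ₁.prod μ₂).restrict (A ×ˢ Set.univ) := by
    rw [hprod, smul_smul, ENNReal.inv_mul_cancel hA0 (measure_ne_top _ _), one_smul]
  have hmL : MemLp (fun p => h p - 1) 2 (m.prod μ₂) := by
    rw [hscale]
    exact (hL.restrict _).smul_measure (ENNReal.inv_ne_top.2 hA0)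
  have hmi : Integrable h (m.prod μ₂) := by
    rw [hscale]
    exact hi.restrict.smul_measure (ENNReal.inv_ne_top.2 hA0)
  -- The mean density on the strip: `ν` gives it mass `μ₁(A) r`. The weight `r` cancels the division
  -- by `r` in `exists_coupling_of_mass`.
  set r := ∫ p, h p ∂(m.prod μ₂) with hr_def
  have hofr : ENNReal.ofReal r = ∫⁻ p, ENNReal.ofReal (h p) ∂(m.prod μ₂) :=
    ofReal_integral_eq_lintegral_ofReal hmi (Eventually.of_forall h0)
  have hq : ν (A ×ˢ Set.univ) = μ₁ A * ENNReal.ofReal r := by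
    rw [hν, withDensity_apply _ (hA.prod MeasurableSet.univ), hprod, lintegral_smul_measure, hofr,
      smul_eq_mul]
  have hr : 0 < r := by
    by_contra! hc
    exact hνA (by rw [hq, ENNReal.ofReal_of_nonpos hc, mul_zero])
  have hr0 : ENNReal.ofReal r ≠ 0 := (ENNReal.ofReal_pos.2 hr).ne'
  set τ := (m.prod μ₂).withDensity (fun p => ENNReal.ofReal (h p)) with hτ
  set σ := (ENNReal.ofReal r)⁻¹ • τ with hσ_def
  have hτσ : τ = ENNReal.ofReal r • σ := by
    rw [hσ_def, smul_smul, ENNReal.mul_inv_cancel hr0 ENNReal.ofReal_ne_top, one_smul]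
  have hστ : ν.restrict (A ×ˢ Set.univ) = ν (A ×ˢ Set.univ) • σ := by
    rw [hrestr, hrestr₁, Measure.prod_smul_left, withDensity_smul_measure, ← hτ, hτσ, smul_smul, hq]
  have hσp : IsProbabilityMeasure σ := by
    constructor
    rw [hσ_def, Measure.smul_apply, hτ, withDensity_apply _ MeasurableSet.univ,
      Measure.restrict_univ, ← hofr, smul_eq_mul, ENNReal.inv_mul_cancel hr0 ENNReal.ofReal_ne_top]
  obtain ⟨X, hX0, hX, hXle⟩ := exists_chiSquare_map_snd_le hm h0 hmL hr hr_def.symm hτσ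
  set Y := ∫ p, (h p - 1) ^ 2 ∂(m.prod μ₂) with hY
  have hY0 : 0 ≤ Y := integral_nonneg fun _ => sq_nonneg _
  have hT := tensorConst_pos d
  have : IsProbabilityMeasure (σ.map Prod.snd) :=
    Measure.isProbabilityMeasure_map measurable_snd.aemeasurable
  obtain ⟨γ, hγ, hcost⟩ := h₂.exists_coupling_of_mass hC₂ hX0 hX hr
    (w := C₂ * tensorConst d * (Y / r) + ε) (by
      refine lt_of_le_of_lt ?_ (lt_add_of_pos_right _ hε)
      gcongr)
  have := hγ.isProbabilityMeasure
  obtain ⟨Γ, hΓ, hΓγ⟩ := exists_gluing hγ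
  refine ⟨Γ, hΓ.map_fst, by rw [hΓ.map_snd, hστ], ?_⟩
  have hcostΓ : ∫⁻ p, ‖p.1 - p.2.2‖ₑ ^ 2 ∂Γ = ∫⁻ p, ‖p.1 - p.2‖ₑ ^ 2 ∂γ := by
    rw [← hΓγ, lintegral_map
      (f := fun p : EuclideanSpace ℝ (Fin d) × EuclideanSpace ℝ (Fin d) => ‖p.1 - p.2‖ₑ ^ 2)
      (by fun_prop) (by fun_prop)]
  have hYint : ∫⁻ p in A ×ˢ Set.univ, ENNReal.ofReal ((h p - 1) ^ 2) ∂(μ₁.prod μ₂)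
      = μ₁ A * ENNReal.ofReal Y := by
    rw [hprod, lintegral_smul_measure, hY, ofReal_integral_eq_lintegral_ofReal hmL.integrable_sq
      (Eventually.of_forall fun _ => sq_nonneg _), smul_eq_mul]
  rw [hcostΓ, hYint]
  calc ν (A ×ˢ Set.univ) * ∫⁻ p, ‖p.1 - p.2‖ₑ ^ 2 ∂γ
      ≤ ν (A ×ˢ Set.univ) * ENNReal.ofReal (C₂ * tensorConst d * (Y / r) + ε) := by gcongr
    _ = ν (A ×ˢ Set.univ) * ENNReal.ofReal (C₂ * tensorConst d * (Y / r))
        + ν (A ×ˢ Set.univ) * ENNReal.ofReal ε := by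
      rw [ENNReal.ofReal_add (by positivity) hε.le, mul_add]
    _ = ENNReal.ofReal (C₂ * tensorConst d) * (μ₁ A * ENNReal.ofReal Y)
        + ν (A ×ˢ Set.univ) * ENNReal.ofReal ε := by
      congr 1
      rw [hq, mul_assoc, ← ENNReal.ofReal_mul hr.le,
        show r * (C₂ * tensorConst d * (Y / r)) = C₂ * tensorConst d * Y by field_simp,
        ENNReal.ofReal_mul (by positivity)]
      ring

omit [MeasurableSpace E] [BorelSpace E] [SecondCountableTopology E] [StandardBorelSpace E] in
-- Young's inequality with weight `η`. The leading factor can be taken arbitrarily close to 1, so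
-- that `C₁` is not degraded.
theorem enorm_sub_sq_le {x y z : E} {η δ : ℝ} (hη : 0 < η) (hyz : ‖y - z‖ ≤ δ) :
    ‖x - z‖ₑ ^ 2 ≤ ENNReal.ofReal (1 + η) * ‖x - y‖ₑ ^ 2 + ENNReal.ofReal ((1 + η⁻¹) * δ ^ 2) := by
  rw [← ofReal_norm, ← ofReal_norm, ← ENNReal.ofReal_pow (norm_nonneg _),
    ← ENNReal.ofReal_pow (norm_nonneg _), ← ENNReal.ofReal_mul (by positivity),
    ← ENNReal.ofReal_add (by positivity) (by positivity)]
  refine ENNReal.ofReal_le_ofReal ?_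
  have h1 : ‖x - z‖ ≤ ‖x - y‖ + δ := (norm_sub_le_norm_sub_add_norm_sub x y z).trans (by linarith)
  have h2 := pow_le_pow_left₀ (norm_nonneg _) h1 2
  have h3 : 0 ≤ (η * ‖x - y‖ - δ) ^ 2 * η⁻¹ := by positivity
  have h4 : (η * ‖x - y‖ - δ) ^ 2 * η⁻¹ = η * ‖x - y‖ ^ 2 - 2 * ‖x - y‖ * δ + η⁻¹ * δ ^ 2 := by
    field_simp
    ring
  linarith [add_sq ‖x - y‖ δ]

/-- Assemble a coupling of `μ₁ ⊗ μ₂` with `ν` from a coupling `π` of the first marginals and the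
couplings on strips of a fine partition of the first space. -/
theorem TransportChiSquare.exists_coupling_prod_of_partition (h₂ : TransportChiSquare μ₂ C₂)
    (hC₂ : 0 ≤ C₂) (hm : Measurable h) (h0 : 0 ≤ h)
    (hL : MemLp (fun p => h p - 1) 2 (μ₁.prod μ₂))
    {ν : Measure (E × EuclideanSpace ℝ (Fin d))} [IsProbabilityMeasure ν]
    (hν : ν = (μ₁.prod μ₂).withDensity fun p => ENNReal.ofReal (h p)) {π : Measure (E × E)}
    (hπ : IsCoupling π μ₁ (ν.map Prod.fst)) {ε η δ : ℝ} (hε : 0 < ε) (hη : 0 < η) (hδ : 0 < δ) :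
    ∃ γ, IsCoupling γ (μ₁.prod μ₂) ν ∧
      ∫⁻ p, (‖p.1.1 - p.2.1‖ₑ ^ 2 + ‖p.1.2 - p.2.2‖ₑ ^ 2) ∂γ ≤
        (ENNReal.ofReal (1 + η) * ∫⁻ p, ‖p.1 - p.2‖ₑ ^ 2 ∂π
          + ENNReal.ofReal ((1 + η⁻¹) * δ ^ 2))
        + (ENNReal.ofReal (C₂ * tensorConst d) *
          (∫⁻ p, ENNReal.ofReal ((h p - 1) ^ 2) ∂(μ₁.prod μ₂)) + ENNReal.ofReal ε) := by
  have := hπ.isProbabilityMeasure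
  obtain ⟨A, hAm, hAd, hAu, hAδ⟩ := exists_measurable_partition_diam_le (E := E) hδ
  choose Γ hΓ1 hΓ2 hΓ3 using fun k => h₂.exists_coupling_strip hC₂ hm h0 hL hν (hAm k) hε
  have hΓp : ∀ k, IsProbabilityMeasure (Γ k) := fun k => by
    have : IsProbabilityMeasure ((Γ k).map Prod.fst) := by rw [hΓ1 k]; infer_instance
    exact Measure.isProbabilityMeasure_of_map Prod.fst
  set S : ℕ → Set (E × EuclideanSpace ℝ (Fin d)) := fun k => A k ×ˢ Set.univ with hS
  have hSm : ∀ k, MeasurableSet (S k) := fun k => (hAm k).prod MeasurableSet.univ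
  have hSd : Pairwise (Function.onFun Disjoint S) := fun i j hij =>
    Set.disjoint_prod.2 (Or.inl (hAd hij))
  have hSu : ⋃ k, S k = Set.univ := by
    rw [hS, ← Set.iUnion_prod_const, hAu, Set.univ_prod_univ]
  set B : ℕ → Set (E × E) := fun k => Prod.snd ⁻¹' A k with hB
  have hBm : ∀ k, MeasurableSet (B k) := fun k => measurable_snd (hAm k)
  have hBd : Pairwise (Function.onFun Disjoint B) := fun i j hij => (hAd hij).preimage _
  have hBu : ⋃ k, B k = Set.univ := by
    rw [hB, ← Set.preimage_iUnion, hAu, Set.preimage_univ]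
  have hπB : ∀ k, π (B k) = ν (S k) := fun k => by
    rw [hB, ← Measure.map_apply measurable_snd (hAm k), hπ.map_snd,
      Measure.map_apply measurable_fst (hAm k), ← Set.prod_univ]
  have hsumπ : Measure.sum (fun k => π.restrict (B k)) = π := by
    rw [← Measure.restrict_iUnion hBd hBm, hBu, Measure.restrict_univ]
  have hsumν : Measure.sum (fun k => ν.restrict (S k)) = ν := by
    rw [← Measure.restrict_iUnion hSd hSm, hSu, Measure.restrict_univ]
  have hsumS : ∑' k, ν (S k) = 1 := by
    rw [← measure_iUnion hSd hSm, hSu, measure_univ]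
  -- If the target of `π` falls in the cell `A k`, the rest is drawn independently from `Γ k`. Every
  -- `Γ k` has first marginal `μ₂`, so the source pair has law `μ₁ ⊗ μ₂`.
  set P := Measure.sum fun k => (π.restrict (B k)).prod (Γ k) with hP
  -- The target `p.1.2` of `π` is dropped in favour of the first coordinate drawn by `Γ k`, which
  -- lies in the same cell, hence within `δ`.
  set F : (E × E) × (EuclideanSpace ℝ (Fin d) × E × EuclideanSpace ℝ (Fin d)) →
      (E × EuclideanSpace ℝ (Fin d)) × (E × EuclideanSpace ℝ (Fin d)) :=
    fun p => ((p.1.1, p.2.1), p.2.2) with hF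
  have hFm : Measurable F := by fun_prop
  refine ⟨P.map F, ⟨?_, ?_⟩, ?_⟩
  · rw [Measure.map_map measurable_fst hFm, hP, Measure.map_sum (by fun_prop)]
    have h1 : ∀ k, ((π.restrict (B k)).prod (Γ k)).map (Prod.fst ∘ F)
        = ((π.restrict (B k)).map Prod.fst).prod μ₂ := fun k => by
      rw [← hΓ1 k, Measure.map_prod_map _ _ measurable_fst measurable_fst]
      rfl
    simp_rw [h1]
    rw [← Measure.prod_sum_left, ← Measure.map_sum measurable_fst.aemeasurable, hsumπ, hπ.map_fst]
  · rw [Measure.map_map measurable_snd hFm, hP, Measure.map_sum (by fun_prop)]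
    have h1 : ∀ k, ((π.restrict (B k)).prod (Γ k)).map (Prod.snd ∘ F) = ν.restrict (S k) := fun k => by
      have e : (Prod.snd ∘ F : _ → E × EuclideanSpace ℝ (Fin d)) = Prod.snd ∘ Prod.snd := rfl
      rw [e, ← Measure.map_map measurable_snd measurable_snd, Measure.map_snd_prod,
        Measure.restrict_apply_univ, hπB, Measure.map_smul]
      exact hΓ2 k
    simp_rw [h1]
    exact hsumν
  · rw [lintegral_map (by fun_prop) hFm, hP, lintegral_sum_measure]
    set c := ENNReal.ofReal ((1 + η⁻¹) * δ ^ 2) with hc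
    have hstrip : ∀ k, ∫⁻ p, (‖(F p).1.1 - (F p).2.1‖ₑ ^ 2 + ‖(F p).1.2 - (F p).2.2‖ₑ ^ 2)
          ∂((π.restrict (B k)).prod (Γ k))
        ≤ (ENNReal.ofReal (1 + η) * ∫⁻ p in B k, ‖p.1 - p.2‖ₑ ^ 2 ∂π + ν (S k) * c)
          + (ENNReal.ofReal (C₂ * tensorConst d) *
            (∫⁻ p in S k, ENNReal.ofReal ((h p - 1) ^ 2) ∂(μ₁.prod μ₂))
              + ν (S k) * ENNReal.ofReal ε) := by
      intro k
      by_cases hk : ν (S k) = 0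
      · rw [Measure.restrict_eq_zero.2 ((hπB k).trans hk), Measure.zero_prod, lintegral_zero_measure]
        exact zero_le
      have hz : ∀ᵐ z ∂(Γ k), z.2.1 ∈ A k := by
        have h1 : ∀ᵐ y ∂(ν (S k) • (Γ k).map Prod.snd), y ∈ S k := by
          rw [hΓ2 k]
          exact ae_restrict_mem (hSm k)
        rw [Measure.ae_ennreal_smul_measure_iff hk] at h1
        filter_upwards [ae_of_ae_map measurable_snd.aemeasurable h1] with z hz using hz.1
      have hae : ∀ᵐ p ∂((π.restrict (B k)).prod (Γ k)), p.1.2 ∈ A k ∧ p.2.2.1 ∈ A k :=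
        (Measure.quasiMeasurePreserving_fst.ae (ae_restrict_mem (hBm k))).and
          (Measure.quasiMeasurePreserving_snd.ae hz)
      have hm1 : Measurable fun q : E × E => ENNReal.ofReal (1 + η) * ‖q.1 - q.2‖ₑ ^ 2 + c := by
        fun_prop
      have hm2 : Measurable fun z : EuclideanSpace ℝ (Fin d) × E × EuclideanSpace ℝ (Fin d) =>
          ‖z.1 - z.2.2‖ₑ ^ 2 := by fun_prop
      have e1 : ∫⁻ p, (ENNReal.ofReal (1 + η) * ‖p.1.1 - p.1.2‖ₑ ^ 2 + c)
            ∂((π.restrict (B k)).prod (Γ k))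
          = ∫⁻ q in B k, (ENNReal.ofReal (1 + η) * ‖q.1 - q.2‖ₑ ^ 2 + c) ∂π := by
        rw [← lintegral_map hm1 measurable_fst, Measure.map_fst_prod, measure_univ, one_smul]
      have e2 : ∫⁻ p, ‖p.2.1 - p.2.2.2‖ₑ ^ 2 ∂((π.restrict (B k)).prod (Γ k))
          = ν (S k) * ∫⁻ z, ‖z.1 - z.2.2‖ₑ ^ 2 ∂(Γ k) := by
        rw [← lintegral_map hm2 measurable_snd, Measure.map_snd_prod,
          Measure.restrict_apply_univ, hπB, lintegral_smul_measure, smul_eq_mul]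
      calc _ ≤ ∫⁻ p, ((ENNReal.ofReal (1 + η) * ‖p.1.1 - p.1.2‖ₑ ^ 2 + c)
              + ‖p.2.1 - p.2.2.2‖ₑ ^ 2) ∂((π.restrict (B k)).prod (Γ k)) := by
            refine lintegral_mono_ae ?_
            filter_upwards [hae] with p hp
            exact add_le_add (enorm_sub_sq_le hη (hAδ k _ hp.1 _ hp.2)) le_rfl
        _ = ∫⁻ q in B k, (ENNReal.ofReal (1 + η) * ‖q.1 - q.2‖ₑ ^ 2 + c) ∂π
            + ν (S k) * ∫⁻ z, ‖z.1 - z.2.2‖ₑ ^ 2 ∂(Γ k) := by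
            rw [lintegral_add_left (f := fun p : (E × E) × (EuclideanSpace ℝ (Fin d) × E ×
              EuclideanSpace ℝ (Fin d)) => ENNReal.ofReal (1 + η) * ‖p.1.1 - p.1.2‖ₑ ^ 2 + c)
              (hm1.comp measurable_fst), ← e1, ← e2]
        _ ≤ _ := by
            refine add_le_add (le_of_eq ?_) (hΓ3 k)
            rw [lintegral_add_right _ measurable_const, lintegral_const_mul _ (by fun_prop),
              lintegral_const, Measure.restrict_apply_univ, hπB, mul_comm c]
    refine (ENNReal.tsum_le_tsum hstrip).trans (le_of_eq ?_)
    rw [ENNReal.tsum_add, ENNReal.tsum_add, ENNReal.tsum_add, ENNReal.tsum_mul_left,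
      ENNReal.tsum_mul_left, ENNReal.tsum_mul_right, ENNReal.tsum_mul_right, hsumS, one_mul, one_mul,
      ← lintegral_iUnion hBm hBd, ← lintegral_iUnion hSm hSd, hBu, hSu, Measure.restrict_univ,
      Measure.restrict_univ]

end Tensorization

/-! ### Tensorization on the product space. -/

section Product

variable {E : Type*} [NormedAddCommGroup E] [MeasurableSpace E] [BorelSpace E]
  [SecondCountableTopology E] [StandardBorelSpace E] {d : ℕ} {μ₁ : Measure E}
  {μ₂ : Measure (EuclideanSpace ℝ (Fin d))} [IsProbabilityMeasure μ₁] [IsProbabilityMeasure μ₂]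
  {C₁ C₂ : ℝ}

theorem map_swap_withDensity_prod {α β : Type*} [MeasurableSpace α] [MeasurableSpace β]
    {μ : Measure α} {ν : Measure β} [SFinite μ] [SFinite ν] {h : α × β → ℝ≥0∞}
    (hm : Measurable h) :
    ((μ.prod ν).withDensity h).map Prod.swap = (ν.prod μ).withDensity fun p => h p.swap := by
  ext s hs
  rw [Measure.map_apply measurable_swap hs, withDensity_apply _ (measurable_swap hs),
    withDensity_apply _ hs, ← Measure.prod_swap (μ := μ) (ν := ν),
    setLIntegral_map (f := fun p : β × α => h p.swap) hs (hm.comp measurable_swap)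
      measurable_swap]
  simp

/-- Tensorization for the product measure, with the cost `|x₁ - y₁|² + |x₂ - y₂|²`. -/
theorem TransportChiSquare.exists_coupling_prod (h₁ : TransportChiSquare μ₁ C₁)
    (h₂ : TransportChiSquare μ₂ C₂) (hC₁ : 0 ≤ C₁) (hC₂ : 0 ≤ C₂)
    {ν : Measure (E × EuclideanSpace ℝ (Fin d))} [IsProbabilityMeasure ν]
    (hfin : chiSquare ν (μ₁.prod μ₂) ≠ ∞) {w : ℝ}
    (hw : (C₁ + C₂ * tensorConst d) * (chiSquare ν (μ₁.prod μ₂)).toReal < w) :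
    ∃ γ, IsCoupling γ (μ₁.prod μ₂) ν ∧
      ∫⁻ p, (‖p.1.1 - p.2.1‖ₑ ^ 2 + ‖p.1.2 - p.2.2‖ₑ ^ 2) ∂γ ≤ ENNReal.ofReal w := by
  obtain ⟨h, hm, h0, hν⟩ := exists_density_of_chiSquare_ne_top hfin
  have hchi : chiSquare ν (μ₁.prod μ₂) = ∫⁻ p, ENNReal.ofReal ((h p - 1) ^ 2) ∂(μ₁.prod μ₂) := by
    conv_lhs => rw [hν]
    exact chiSquare_withDensity hm h0
  have hL : MemLp (fun p => h p - 1) 2 (μ₁.prod μ₂) :=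
    memLp_of_lintegral_sq_sub_one hm (hchi ▸ hfin)
  set Y := (chiSquare ν (μ₁.prod μ₂)).toReal with hY
  have hY0 : 0 ≤ Y := ENNReal.toReal_nonneg
  have hYeq : ∫⁻ p, ENNReal.ofReal ((h p - 1) ^ 2) ∂(μ₁.prod μ₂) = ENNReal.ofReal Y := by
    rw [← hchi, hY, ENNReal.ofReal_toReal hfin]
  have hYint : ∫ p, (h p - 1) ^ 2 ∂(μ₁.prod μ₂) = Y := by
    rw [← ofReal_integral_eq_lintegral_ofReal hL.integrable_sq
      (Eventually.of_forall fun _ => sq_nonneg _)] at hYeq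
    exact (ENNReal.ofReal_eq_ofReal_iff (integral_nonneg fun _ => sq_nonneg _) hY0).1 hYeq
  have hmass : ∫ p, h p ∂(μ₁.prod μ₂) = 1 := by
    have h1 : ∫⁻ p, ENNReal.ofReal (h p) ∂(μ₁.prod μ₂) = 1 := by
      have h2 : ν Set.univ = 1 := measure_univ
      rwa [hν, withDensity_apply _ MeasurableSet.univ, Measure.restrict_univ] at h2
    rw [integral_eq_lintegral_of_nonneg_ae (Eventually.of_forall h0) hm.aestronglyMeasurable, h1]
    simp
  -- Averaging with total mass `r = 1`, after a swap, bounds the chi-square of the first marginal by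
  -- that of `ν`.
  obtain ⟨X, hX0, hX, hXle⟩ := exists_chiSquare_map_snd_le (μ := μ₂) (ν := μ₁)
    (h := fun p => h p.swap) (hm.comp measurable_swap) (fun p => h0 p.swap)
    (hL.comp_measurePreserving Measure.measurePreserving_swap) one_pos
    (by rw [← hmass]; exact integral_prod_swap h) (σ := ν.map Prod.swap)
    (by rw [hν, map_swap_withDensity_prod hm.ennreal_ofReal]; simp)
  have hXY : X ≤ Y := by
    have h1 : ∫ p, (h p.swap - 1) ^ 2 ∂(μ₂.prod μ₁) = Y := by
      rw [← hYint]
      exact integral_prod_swap fun p => (h p - 1) ^ 2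
    rw [h1] at hXle
    linarith
  have hmar : (ν.map Prod.swap).map Prod.snd = ν.map Prod.fst := by
    rw [Measure.map_map measurable_snd measurable_swap]
    rfl
  rw [hmar] at hX
  have : IsProbabilityMeasure (ν.map Prod.fst) :=
    Measure.isProbabilityMeasure_map measurable_fst.aemeasurable
  have hT := tensorConst_pos d
  -- The slack `g` is spent in four quarters: on the coupling `π`, on the factor `1 + η`, on the
  -- mesh `δ`, and on the couplings in strips.
  set g := w - (C₁ + C₂ * tensorConst d) * Y with hg
  have hg0 : 0 < g := sub_pos.2 hw
  set w₁ := C₁ * Y + g / 4 with hw₁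
  have hw₁0 : 0 < w₁ := by positivity
  obtain ⟨π, hπ, hcost⟩ := h₁.exists_coupling hC₁ hX hX0 (w := w₁)
    (by nlinarith [mul_le_mul_of_nonneg_left hXY hC₁])
  set η := g / (4 * w₁) with hη
  have hη0 : 0 < η := by positivity
  set δ := √(g / 4 / (1 + η⁻¹)) with hδ
  have hδ0 : 0 < δ := Real.sqrt_pos.2 (by positivity)
  obtain ⟨γ, hγ, hγc⟩ := h₂.exists_coupling_prod_of_partition hC₂ hm h0 hL hν hπ
    (ε := g / 4) (by positivity) hη0 hδ0
  refine ⟨γ, hγ, hγc.trans ?_⟩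
  have e1 : (1 + η⁻¹) * δ ^ 2 = g / 4 := by
    rw [hδ, Real.sq_sqrt (by positivity)]
    field_simp
  have e2 : (1 + η) * w₁ = w₁ + g / 4 := by
    rw [hη]
    field_simp
  rw [hYeq, e1]
  calc _ ≤ (ENNReal.ofReal (1 + η) * ENNReal.ofReal w₁ + ENNReal.ofReal (g / 4))
        + (ENNReal.ofReal (C₂ * tensorConst d) * ENNReal.ofReal Y + ENNReal.ofReal (g / 4)) := by
        gcongr
    _ = ENNReal.ofReal ((1 + η) * w₁ + g / 4 + (C₂ * tensorConst d * Y + g / 4)) := by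
        rw [← ENNReal.ofReal_mul (by positivity), ← ENNReal.ofReal_mul (by positivity),
          ← ENNReal.ofReal_add (by positivity) (by positivity),
          ← ENNReal.ofReal_add (by positivity) (by positivity),
          ← ENNReal.ofReal_add (by positivity) (by positivity)]
    _ ≤ ENNReal.ofReal w := by
        refine ENNReal.ofReal_le_ofReal ?_
        rw [e2, hw₁]
        linarith

end Product

/-! ### Transfer to the Euclidean space of concatenated coordinates. -/

section Euclidean

variable {d₁ d₂ : ℕ}

theorem norm_sq_eq_finAddEquivProd (x : EuclideanSpace ℝ (Fin (d₁ + d₂))) :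
    ‖x‖ ^ 2 = ‖(EuclideanSpace.finAddEquivProd (𝕜 := ℝ) (n := d₁) (m := d₂) x).1‖ ^ 2
      + ‖(EuclideanSpace.finAddEquivProd (𝕜 := ℝ) (n := d₁) (m := d₂) x).2‖ ^ 2 := by
  have h := (((LinearIsometryEquiv.piLpCongrLeft 2 ℝ ℝ
    (finSumFinEquiv (m := d₁) (n := d₂)).symm).trans
    (PiLp.sumPiLpEquivProdLpPiLp 2 fun _ => ℝ)).norm_map x)
  rw [← h, WithLp.prod_norm_sq_eq_of_L2]
  rfl

theorem enorm_sub_sq_eq_finAddEquivProd (x y : EuclideanSpace ℝ (Fin d₁) × EuclideanSpace ℝ (Fin d₂)) :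
    ‖(EuclideanSpace.finAddEquivProd (𝕜 := ℝ)).symm x
        - (EuclideanSpace.finAddEquivProd (𝕜 := ℝ)).symm y‖ₑ ^ 2
      = ‖x.1 - y.1‖ₑ ^ 2 + ‖x.2 - y.2‖ₑ ^ 2 := by
  simp only [← ofReal_norm]
  rw [← ENNReal.ofReal_pow (norm_nonneg _), ← ENNReal.ofReal_pow (norm_nonneg _),
    ← ENNReal.ofReal_pow (norm_nonneg _), ← ENNReal.ofReal_add (by positivity) (by positivity),
    norm_sq_eq_finAddEquivProd, ← map_sub, ContinuousLinearEquiv.apply_symm_apply]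
  rfl

/-- To prove the inequality for `μ₁ ⊗ μ₂` it suffices to couple on the product space. -/
theorem transportChiSquare_tensorMeasure_of_exists_coupling
    {μ₁ : Measure (EuclideanSpace ℝ (Fin d₁))} {μ₂ : Measure (EuclideanSpace ℝ (Fin d₂))}
    [IsProbabilityMeasure μ₁] [IsProbabilityMeasure μ₂] {C : ℝ} (hC : 0 ≤ C)
    (h : ∀ ν : Measure (EuclideanSpace ℝ (Fin d₁) × EuclideanSpace ℝ (Fin d₂)),
      IsProbabilityMeasure ν → chiSquare ν (μ₁.prod μ₂) ≠ ∞ → ∀ w : ℝ,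
      C * (chiSquare ν (μ₁.prod μ₂)).toReal < w →
      ∃ γ, IsCoupling γ (μ₁.prod μ₂) ν ∧
        ∫⁻ p, (‖p.1.1 - p.2.1‖ₑ ^ 2 + ‖p.1.2 - p.2.2‖ₑ ^ 2) ∂γ ≤ ENNReal.ofReal w) :
    TransportChiSquare (tensorMeasure μ₁ μ₂) C := by
  set e : EuclideanSpace ℝ (Fin d₁) × EuclideanSpace ℝ (Fin d₂) ≃ᵐ
      EuclideanSpace ℝ (Fin (d₁ + d₂)) :=
    (EuclideanSpace.finAddEquivProd (𝕜 := ℝ) (n := d₁) (m := d₂)).symm.toHomeomorph.toMeasurableEquiv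
    with he
  have hem : tensorMeasure μ₁ μ₂ = (μ₁.prod μ₂).map e := rfl
  refine transportChiSquare_of_exists_coupling hC fun ν hν hfin w hw => ?_
  have hνe : ν = (ν.map e.symm).map e := by simp
  have hchi : chiSquare ν (tensorMeasure μ₁ μ₂) = chiSquare (ν.map e.symm) (μ₁.prod μ₂) := by
    conv_lhs => rw [hem, hνe]
    exact chiSquare_map_equiv e
  rw [hchi] at hfin hw
  obtain ⟨γ, hγ, hc⟩ := h _ (Measure.isProbabilityMeasure_map e.symm.measurable.aemeasurable)
    hfin w hw
  have hee : Measurable (Prod.map e e) := e.measurable.prodMap e.measurable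
  refine ⟨γ.map (Prod.map e e), ⟨?_, ?_⟩, ?_⟩
  · rw [Measure.map_map measurable_fst hee, hem, ← hγ.map_fst,
      Measure.map_map e.measurable measurable_fst]
    rfl
  · conv_rhs => rw [hνe, ← hγ.map_snd]
    rw [Measure.map_map measurable_snd hee, Measure.map_map e.measurable measurable_snd]
    rfl
  · rw [lintegral_map (by fun_prop) hee]
    refine (lintegral_congr fun p => ?_).trans_le hc
    exact enorm_sub_sq_eq_finAddEquivProd p.1 p.2

end Euclidean

end

/-! ### The theorem, symmetrized by exchanging the two factors. -/

theorem theorem2 {d₁ d₂ : ℕ}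
    (μ₁ : Measure (EuclideanSpace ℝ (Fin d₁))) (μ₂ : Measure (EuclideanSpace ℝ (Fin d₂)))
    [IsProbabilityMeasure μ₁] [IsProbabilityMeasure μ₂]
    {C₁ C₂ : ℝ} (hC₁ : 0 ≤ C₁) (hC₂ : 0 ≤ C₂)
    (h₁ : TransportChiSquare μ₁ C₁) (h₂ : TransportChiSquare μ₂ C₂) :
    TransportChiSquare (tensorMeasure μ₁ μ₂)
      (min (C₁ + C₂ * (1 + √((3 * (d₂ : ℝ) + 2) * (d₂ : ℝ))))
        (C₂ + C₁ * (1 + √((3 * (d₁ : ℝ) + 2) * (d₁ : ℝ))))) := by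
  have hT₁ := tensorConst_pos d₁
  have hT₂ := tensorConst_pos d₂
  change TransportChiSquare _ (min (C₁ + C₂ * tensorConst d₂) (C₂ + C₁ * tensorConst d₁))
  rcases min_choice (C₁ + C₂ * tensorConst d₂) (C₂ + C₁ * tensorConst d₁) with hmin | hmin <;>
    rw [hmin]
  · exact transportChiSquare_tensorMeasure_of_exists_coupling (by positivity)
      fun ν _ hfin w hw => h₁.exists_coupling_prod h₂ hC₁ hC₂ hfin hw
  -- The other constant results from exchanging the roles of the factors and swapping the coupling
  -- back.
  · refine transportChiSquare_tensorMeasure_of_exists_coupling (by positivity)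
      fun ν _ hfin w hw => ?_
    have hchi : chiSquare (ν.map Prod.swap) (μ₂.prod μ₁) = chiSquare ν (μ₁.prod μ₂) := by
      rw [← Measure.prod_swap (μ := μ₁) (ν := μ₂)]
      exact chiSquare_map_equiv (MeasurableEquiv.prodComm
        (α := EuclideanSpace ℝ (Fin d₁)) (β := EuclideanSpace ℝ (Fin d₂)))
    have : IsProbabilityMeasure (ν.map Prod.swap) :=
      Measure.isProbabilityMeasure_map measurable_swap.aemeasurable
    rw [← hchi] at hfin hw
    obtain ⟨γ, hγ, hc⟩ := h₂.exists_coupling_prod h₁ hC₂ hC₁ hfin hw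
    set S : EuclideanSpace ℝ (Fin d₂) × EuclideanSpace ℝ (Fin d₁) →
      EuclideanSpace ℝ (Fin d₁) × EuclideanSpace ℝ (Fin d₂) := Prod.swap with hS
    have hss : Measurable (Prod.map S S) := measurable_swap.prodMap measurable_swap
    refine ⟨γ.map (Prod.map S S), ⟨?_, ?_⟩, ?_⟩
    · rw [Measure.map_map measurable_fst hss, ← Measure.prod_swap, ← hγ.map_fst,
        Measure.map_map measurable_swap measurable_fst]
      rfl
    · have hνs : ν = (ν.map Prod.swap).map Prod.swap := by
        rw [Measure.map_map measurable_swap measurable_swap]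
        simp
      conv_rhs => rw [hνs, ← hγ.map_snd]
      rw [Measure.map_map measurable_snd hss, Measure.map_map measurable_swap measurable_snd]
      rfl
    · rw [lintegral_map (by fun_prop) hss]
      refine (lintegral_congr fun p => ?_).trans_le hc
      exact add_comm _ _
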